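/- **Lemma 1.3.** Let $B$ be a connected closed (smooth) manifold, and let $\mathcal H_1,\mathcal H_1',\mathcal H_2,\mathcal H_2'$ be bundles of complex Hilbert spaces over $B$, with fibers $H_{1,b},H_{1,b}',H_{2,b},H_{2,b}'$ over $b\in B$: fiber bundles modelled on Hilbert spaces, with fiberwise linear local trivializations. (The trivializations need not be isometric, and the transition functions $g$ are only required to make $(b,v)\mapsto g_b v$ continuous.) Let $$P=\{P_b\colon H_{1,b}\to H_{1,b}'\}_{b\in B},\qquad Q=\{Q_b\colon H_{2,b}\to H_{2,b}'\}_{b\in B}$$ be continuous families of Fredholm operators, that is, all $P_b$, $Q_b$ are bounded Fredholm operators and each family is, near every point of $B$ and in suitable linear local trivializations of the two bundles involved, continuous in the operator norm. Let $$\varphi=\{\varphi_b\colon H_{1,b}\to H_{2,b}\}_{b\in B},\qquad \psi=\{\psi_b\colon H_{1,b}'\to H_{2,b}'\}_{b\in B}$$ be continuous families of bounded linear operators (it suffices that they are continuous as maps of the total spaces) with $\psi_b P_b=Q_b\varphi_b$ for all $b\in B$. Let $\mu_b\colon\operatorname{Ker}P_b\to\operatorname{Ker}Q_b$ and $\eta_b\colon\operatorname{Coker}P_b\to\operatorname{Coker}Q_b$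 be the maps induced by $\varphi_b$ and $\psi_b$. The index bundle of a continuous family $T=\{T_b\colon E_b\to E_b'\}_{b\in B}$ of Fredholm operators between Hilbert bundles over $B$ is defined as follows. Choose $l\in\mathbb N$ and continuous global sections $w_1,\dots,w_l$ of the target bundle such that $$\widetilde T_b\colon E_b\oplus\mathbb C^l\to E_b',\qquad \widetilde T_b(u;z_1,\dots,z_l)=T_b(u)+\sum_{k=1}^l z_k w_k(b),$$ is surjective for every $b\in B$; then the spaces $\operatorname{Ker}\widetilde T_b$ form a complex vector bundle of finite rank $\operatorname{Ker}\widetilde T$ over $B$ (with the topology induced from the total space of $E\oplus\mathbb C^l$), and $$\operatorname{Ind}(T)=[\operatorname{Ker}\widetilde T]-[\mathbb C^l]\in K^0(B),$$ where $K^0(B)$ is the Grothendieck group of isomorphism classes of complex vector bundles of finite rank over $B$, and $[\mathbb C^l]$ is the class of the trivial bundle of rank $l$. If $\mu_b$ and $\eta_b$ are isomorphisms for all $b\in B$, then $\operatorname{Ind}(P)$ and $\operatorname{Ind}(Q)$ are well defined (such choices exist, and the resulting class does not depend on them), and $$\operatorname{Ind}(P)=\operatorname{Ind}(Q)\in K^0(B).$$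 -/

import Mathlib

open Bundle Topology
open scoped Manifold ContDiff

noncomputable section

/-! ### Complex vector bundles of finite rank and the group `K⁰(B)` -/

/-- A complex vector bundle of finite rank over `B` (with constant rank, which is no restriction
over a connected base). The fibres live in `Type`; up to isomorphism this is no restriction. -/
structure CVectBundle (B : Type*) [TopologicalSpace B] where
  /-- the model fibre -/
  F : Type
  /-- the fibres -/
  E : B → Type
  [normF : NormedAddCommGroup F]
  [spaceF : NormedSpace ℂ F]
  [finF : FiniteDimensional ℂ F]
  [grpE : ∀ b, AddCommGroup (E b)]
  [modE : ∀ b, Module ℂ (E b)]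
  [topE : ∀ b, TopologicalSpace (E b)]
  [topTotal : TopologicalSpace (TotalSpace F E)]
  [fiber : FiberBundle F E]
  [vector : VectorBundle ℂ F E]

namespace CVectBundle

attribute [instance] normF spaceF finF grpE modE topE topTotal fiber vector

variable {B : Type*} [TopologicalSpace B]

/-- The total space. -/
abbrev Total (V : CVectBundle B) : Type _ := TotalSpace V.F V.E

/-- Isomorphism of vector bundles over `B`: fibrewise linear isomorphisms that form, together with
their inverses, continuous maps of the total spaces. -/
structure Iso (V W : CVectBundle B) where
  toEquiv : ∀ b, V.E b ≃ₗ[ℂ] W.E b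
  continuous_toFun : Continuous fun p : V.Total => (⟨p.1, toEquiv p.1 p.2⟩ : W.Total)
  continuous_invFun : Continuous fun p : W.Total => (⟨p.1, (toEquiv p.1).symm p.2⟩ : V.Total)

/-- The trivial bundle `B × F`. -/
def trivial (B : Type*) [TopologicalSpace B] (F : Type) [NormedAddCommGroup F] [NormedSpace ℂ F]
    [FiniteDimensional ℂ F] : CVectBundle B where
  F := F
  E := Bundle.Trivial B F

/-- The direct (Whitney) sum of two vector bundles. -/
def sum (V W : CVectBundle B) : CVectBundle B where
  F := V.F × W.F
  E := V.E ×ᵇ W.E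

theorem continuous_sum_fst (V W : CVectBundle B) :
    Continuous fun p : (V.sum W).Total => (⟨p.1, p.2.1⟩ : V.Total) :=
  (FiberBundle.Prod.isInducing_diag V.F V.E W.F W.E).continuous.fst

theorem continuous_sum_snd (V W : CVectBundle B) :
    Continuous fun p : (V.sum W).Total => (⟨p.1, p.2.2⟩ : W.Total) :=
  (FiberBundle.Prod.isInducing_diag V.F V.E W.F W.E).continuous.snd

theorem continuous_to_sum {X : Type*} [TopologicalSpace X] {V W : CVectBundle B}
    {f : X → (V.sum W).Total}
    (h₁ : Continuous fun x => (⟨(f x).1, (f x).2.1⟩ : V.Total))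
    (h₂ : Continuous fun x => (⟨(f x).1, (f x).2.2⟩ : W.Total)) : Continuous f :=
  (FiberBundle.Prod.isInducing_diag V.F V.E W.F W.E).continuous_iff.2 (h₁.prodMk h₂)

theorem continuous_proj (V : CVectBundle B) : Continuous fun p : V.Total => p.1 :=
  FiberBundle.continuous_proj V.F V.E

namespace Iso

def refl (V : CVectBundle B) : Iso V V where
  toEquiv b := LinearEquiv.refl ℂ (V.E b)
  continuous_toFun := continuous_id
  continuous_invFun := continuous_id

def symm {V W : CVectBundle B} (f : Iso V W) : Iso W V where
  toEquiv b := (f.toEquiv b).symm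
  continuous_toFun := f.continuous_invFun
  continuous_invFun := f.continuous_toFun

def trans {V W X : CVectBundle B} (f : Iso V W) (g : Iso W X) : Iso V X where
  toEquiv b := (f.toEquiv b).trans (g.toEquiv b)
  continuous_toFun := g.continuous_toFun.comp f.continuous_toFun
  continuous_invFun := f.continuous_invFun.comp g.continuous_invFun

def sumCongr {V V' W W' : CVectBundle B} (f : Iso V V') (g : Iso W W') :
    Iso (V.sum W) (V'.sum W') where
  toEquiv b := (f.toEquiv b).prodCongr (g.toEquiv b)
  continuous_toFun := continuous_to_sum (f.continuous_toFun.comp (continuous_sum_fst V W))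
    (g.continuous_toFun.comp (continuous_sum_snd V W))
  continuous_invFun := continuous_to_sum (f.continuous_invFun.comp (continuous_sum_fst V' W'))
    (g.continuous_invFun.comp (continuous_sum_snd V' W'))

def sumComm (V W : CVectBundle B) : Iso (V.sum W) (W.sum V) where
  toEquiv b := LinearEquiv.prodComm ℂ (V.E b) (W.E b)
  continuous_toFun := continuous_to_sum (continuous_sum_snd V W) (continuous_sum_fst V W)
  continuous_invFun := continuous_to_sum (continuous_sum_snd W V) (continuous_sum_fst W V)

def sumAssoc (V W X : CVectBundle B) : Iso ((V.sum W).sum X) (V.sum (W.sum X)) where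
  toEquiv b := LinearEquiv.prodAssoc ℂ (V.E b) (W.E b) (X.E b)
  continuous_toFun := continuous_to_sum
    ((continuous_sum_fst V W).comp (continuous_sum_fst (V.sum W) X))
    (continuous_to_sum ((continuous_sum_snd V W).comp (continuous_sum_fst (V.sum W) X))
      (continuous_sum_snd (V.sum W) X))
  continuous_invFun := continuous_to_sum
    (continuous_to_sum (continuous_sum_fst V (W.sum X))
      ((continuous_sum_fst W X).comp (continuous_sum_snd V (W.sum X))))
    ((continuous_sum_snd W X).comp (continuous_sum_snd V (W.sum X)))

def zeroSum (V : CVectBundle B) : Iso ((trivial B PUnit).sum V) V where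
  toEquiv b := LinearEquiv.uniqueProd (R := ℂ) (M := V.E b) (M₂ := PUnit)
  continuous_toFun := continuous_sum_snd _ V
  continuous_invFun := by
    refine continuous_to_sum ?_ continuous_id
    have h : Continuous fun b : B => ((b, PUnit.unit) : B × PUnit) := by fun_prop
    exact ((Bundle.Trivial.homeomorphProd B PUnit).symm.continuous.comp h).comp (continuous_proj V)

end Iso

instance isoSetoid (B : Type*) [TopologicalSpace B] : Setoid (CVectBundle B) where
  r V W := Nonempty (Iso V W)
  iseqv := ⟨fun V => ⟨Iso.refl V⟩, fun ⟨f⟩ => ⟨f.symm⟩, fun ⟨f⟩ ⟨g⟩ => ⟨f.trans g⟩⟩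

end CVectBundle

/-- Isomorphism classes of complex vector bundles of finite rank over `B`. -/
def VectClass (B : Type*) [TopologicalSpace B] := Quotient (CVectBundle.isoSetoid B)

namespace VectClass

variable {B : Type*} [TopologicalSpace B]

/-- The isomorphism class of a vector bundle. -/
def mk (V : CVectBundle B) : VectClass B := Quotient.mk _ V

instance : Add (VectClass B) where
  add := Quotient.map₂ CVectBundle.sum
    fun _ _ ⟨f⟩ _ _ ⟨g⟩ => ⟨CVectBundle.Iso.sumCongr f g⟩

instance : Zero (VectClass B) where
  zero := mk (CVectBundle.trivial B PUnit)

/-- Isomorphism classes form a commutative monoid under direct sum. -/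
instance : AddCommMonoid (VectClass B) where
  add_assoc := by
    rintro ⟨V⟩ ⟨W⟩ ⟨X⟩
    exact Quotient.sound ⟨CVectBundle.Iso.sumAssoc V W X⟩
  zero_add := by
    rintro ⟨V⟩
    exact Quotient.sound ⟨CVectBundle.Iso.zeroSum V⟩
  add_zero := by
    rintro ⟨V⟩
    exact Quotient.sound ⟨(CVectBundle.Iso.sumComm V _).trans (CVectBundle.Iso.zeroSum V)⟩
  add_comm := by
    rintro ⟨V⟩ ⟨W⟩
    exact Quotient.sound ⟨CVectBundle.Iso.sumComm V W⟩
  nsmul := nsmulRec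

theorem mk_sum (V W : CVectBundle B) : mk (V.sum W) = mk V + mk W := rfl

end VectClass

/-- The topological K-group `K⁰(B)` of a connected compact Hausdorff space: the Grothendieck group
of the monoid of isomorphism classes of complex vector bundles of finite rank. -/
abbrev KZero (B : Type*) [TopologicalSpace B] := Algebra.GrothendieckAddGroup (VectClass B)

/-- The class `[V] ∈ K⁰(B)` of a vector bundle. -/
def KZero.ofBundle {B : Type*} [TopologicalSpace B] (V : CVectBundle B) : KZero B :=
  Algebra.GrothendieckAddGroup.of (VectClass.mk V)

/-! ### Hilbert bundles and families of operators -/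

/-- A bundle of Hilbert spaces over `B` with model fibre the Hilbert space `F` is a fibre bundle
whose local trivializations are fibrewise linear (hence, on each fibre, isomorphisms of topological
vector spaces `E b ≃ F`). The trivializations need not be isometric on the fibres, and the transition functions
`U ∩ U' → GL(F)` need only be continuous in the sense that `(b, v) ↦ g b v` is continuous, as is
usual for bundles of `L²`-spaces; Hilbert bundles with unitary or with norm continuous transition
functions are special cases. -/
class HilbertBundle {B : Type*} [TopologicalSpace B]
    (F : Type*) [NormedAddCommGroup F] [InnerProductSpace ℂ F] [CompleteSpace F]
    (E : B → Type*) [∀ b, NormedAddCommGroup (E b)] [∀ b, InnerProductSpace ℂ (E b)]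
    [TopologicalSpace (TotalSpace F E)] [FiberBundle F E] : Prop where
  trivialization_linear : ∀ (e : Trivialization F (π F E)) [MemTrivializationAtlas e], e.IsLinear ℂ

section Families

variable {B : Type*} [TopologicalSpace B]
  (F : Type*) [NormedAddCommGroup F] [InnerProductSpace ℂ F]
  (F' : Type*) [NormedAddCommGroup F'] [InnerProductSpace ℂ F']
  {E : B → Type*} [∀ b, NormedAddCommGroup (E b)] [∀ b, InnerProductSpace ℂ (E b)]
  [TopologicalSpace (TotalSpace F E)] [FiberBundle F E]
  {E' : B → Type*} [∀ b, NormedAddCommGroup (E' b)] [∀ b, InnerProductSpace ℂ (E' b)]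
  [TopologicalSpace (TotalSpace F' E')] [FiberBundle F' E']

/-- The family `T b : E b → E' b` of bounded operators is continuous as a map of total spaces,
`(b, u) ↦ (b, T b u)`. -/
def IsContinuousBundleMap (T : ∀ b, E b →L[ℂ] E' b) : Prop :=
  Continuous fun p : TotalSpace F E => (⟨p.1, T p.1 p.2⟩ : TotalSpace F' E')

/-- The family `T b : E b → E' b` of bounded operators is norm continuous: near each point of the
base there are linear local trivializations of the two bundles in which it becomes a family of
operators `F → F'` between the model fibres that is continuous for the operator norm. -/
def IsNormContinuousFamily (T : ∀ b, E b →L[ℂ] E' b) : Prop :=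
  ∀ b₀ : B, ∃ (e : Trivialization F (π F E)) (e' : Trivialization F' (π F' E'))
    (_ : e.IsLinear ℂ) (_ : e'.IsLinear ℂ), b₀ ∈ e.baseSet ∩ e'.baseSet ∧
      ContinuousOn
        (fun b => (e'.continuousLinearMapAt ℂ b).comp ((T b).comp (e.symmL ℂ b)) : B → F →L[ℂ] F')
        (e.baseSet ∩ e'.baseSet)

/-- A continuous family of Fredholm operators between Hilbert bundles. -/
structure IsFredholmFamily (T : ∀ b, E b →L[ℂ] E' b) : Prop where
  isFredholm : ∀ b, (T b).IsFredholm
  normContinuous : IsNormContinuousFamily F F' T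

/-- For sections `w 1, …, w l` of `E'`, the operator
`E b ⊕ ℂˡ → E' b`, `(u, z) ↦ T b u + ∑ k, z k • w k b`. -/
def stabilized (T : ∀ b, E b →L[ℂ] E' b) {l : ℕ} (w : Fin l → ∀ b, E' b) (b : B) :
    E b × (Fin l → ℂ) →ₗ[ℂ] E' b where
  toFun p := T b p.1 + ∑ k, p.2 k • w k b
  map_add' p q := by
    simp only [Prod.fst_add, Prod.snd_add, map_add, Pi.add_apply, add_smul, Finset.sum_add_distrib]
    abel
  map_smul' c p := by
    simp [mul_smul, Finset.smul_sum]

/-- `V` is (a copy of) the kernel bundle of the family `S b : E b ⊕ ℂˡ → E' b`: there are injective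
linear maps `ι b : V b → E b ⊕ ℂˡ` with image `ker (S b)`, which together embed the total space
of `V` topologically into that of `E ⊕ ℂˡ`. -/
def IsKernelBundle {l : ℕ} (S : ∀ b, E b × (Fin l → ℂ) →ₗ[ℂ] E' b) (V : CVectBundle B) : Prop :=
  ∃ ι : ∀ b, V.E b →ₗ[ℂ] E b × (Fin l → ℂ),
    (∀ b, Function.Injective (ι b)) ∧ (∀ b, LinearMap.range (ι b) = LinearMap.ker (S b)) ∧
    IsEmbedding fun p : V.Total =>
      (((⟨p.1, (ι p.1 p.2).1⟩ : TotalSpace F E), (ι p.1 p.2).2) : TotalSpace F E × (Fin l → ℂ))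

/-- `x ∈ K⁰(B)` is the class `[Ker T̃] - [ℂˡ]` for some continuous sections `w 1, …, w l` of `E'`
such that `T̃ b (u, z) = T b u + ∑ k, z k • w k b` is surjective for all `b`. -/
def IsIndexClass (T : ∀ b, E b →L[ℂ] E' b) (x : KZero B) : Prop :=
  ∃ (l : ℕ) (w : Fin l → ∀ b, E' b) (V : CVectBundle B),
    (∀ k, Continuous fun b => (⟨b, w k b⟩ : TotalSpace F' E')) ∧
    (∀ b, Function.Surjective (stabilized T w b)) ∧
    IsKernelBundle F (stabilized T w) V ∧
    x = KZero.ofBundle V - KZero.ofBundle (CVectBundle.trivial B (Fin l → ℂ))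

open Classical in
/-- The index bundle `Ind T = [Ker T̃] - [ℂˡ] ∈ K⁰(B)` of a continuous family of Fredholm
operators (by convention `0` for families `T` that do not admit any such `T̃`). -/
def indexBundle (T : ∀ b, E b →L[ℂ] E' b) : KZero B :=
  if h : ∃ x, IsIndexClass F F' T x then h.choose else 0

end Families

/-! ### Induced maps on kernels and cokernels -/

section Induced

variable {H₁ H₁' H₂ H₂' : Type*}
  [NormedAddCommGroup H₁] [InnerProductSpace ℂ H₁] [NormedAddCommGroup H₁'] [InnerProductSpace ℂ H₁']
  [NormedAddCommGroup H₂] [InnerProductSpace ℂ H₂] [NormedAddCommGroup H₂'] [InnerProductSpace ℂ H₂']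
  (P : H₁ →L[ℂ] H₁') (Q : H₂ →L[ℂ] H₂') (φ : H₁ →L[ℂ] H₂) (ψ : H₁' →L[ℂ] H₂')

theorem map_ker_mem (h : ψ.comp P = Q.comp φ) (u : H₁) (hu : u ∈ P.ker) : φ u ∈ Q.ker := by
  have h' : ψ (P u) = Q (φ u) := congrArg (fun T => T u) h
  have hu' : P u = 0 := hu
  rw [hu', map_zero] at h'
  exact h'.symm

theorem range_le_comap (h : ψ.comp P = Q.comp φ) : P.range ≤ Q.range.comap (ψ : H₁' →ₗ[ℂ] H₂') := by
  rintro _ ⟨u, rfl⟩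
  exact ⟨φ u, (congrArg (fun T => T u) h).symm⟩

/-- The map `Ker P → Ker Q` induced by `φ` in a commutative square `ψ P = Q φ`. -/
def inducedKer (h : ψ.comp P = Q.comp φ) : P.ker →ₗ[ℂ] Q.ker :=
  (φ : H₁ →ₗ[ℂ] H₂).restrict (map_ker_mem P Q φ ψ h)

/-- The map `Coker P → Coker Q` induced by `ψ` in a commutative square `ψ P = Q φ`. -/
def inducedCoker (h : ψ.comp P = Q.comp φ) : (H₁' ⧸ P.range) →ₗ[ℂ] (H₂' ⧸ Q.range) :=
  P.range.mapQ Q.range (ψ : H₁' →ₗ[ℂ] H₂') (range_le_comap P Q φ ψ h)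

end Induced

end

/-! Stabilize `P` by sections `w k` to a surjective `P̃`, and `Q` by the sections `ψ (w k)` to `Q̃`.
As `P̃` is onto, `0 → Ker P → Ker P̃ → ℂˡ → Coker P → 0` is exact in each fibre. Surjectivity of `η`
makes `Q̃` onto, so `Q` has the same exact sequence, and the five lemma for `μ`, `id`, `η` shows
that `φ ⊕ id` maps `Ker P̃` bijectively onto `Ker Q̃` (the `stabilized_map` lemmas). This map is
continuous, and a continuous fibrewise linear bijection of finite rank bundles is an isomorphism
(`CVectBundle.Iso.ofContinuous`). The same `[ℂˡ]` is subtracted on both sides.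

The rest shows that the index is well defined. Read in suitable trivializations, a surjective
stabilization is norm continuous; bordering it by a projection onto its kernel at one point gives
invertible operators nearby, whose inverses contain a right inverse and a frame of the kernels
(`exists_local_splitting`, `exists_kernelFrame`). The frames glue to the kernel bundle, of constant
rank by connectedness; partitions of unity yield the global sections `w k` and global lifts. Two
stabilizations are compared with the one by all their sections together: lifting the additional
sections splits off a trivial summand of the larger kernel (`ofBundle_kernel_enlarge`). -/

/-! ### Local splitting of families of surjective operators. -/

/-- A family of operators that is continuous near `x₀`, and at `x₀` surjective with
finite-dimensional kernel, has near `x₀` a continuous right inverse `R` and a continuous frame `θ`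
of the kernels. -/
theorem exists_local_splitting {X M N : Type*} [TopologicalSpace X]
    [NormedAddCommGroup M] [NormedSpace ℂ M] [CompleteSpace M]
    [NormedAddCommGroup N] [NormedSpace ℂ N] [CompleteSpace N]
    {A : X → M →L[ℂ] N} {x₀ : X} (hA : ∀ᶠ x in 𝓝 x₀, ContinuousAt A x)
    (hs : Function.Surjective (A x₀)) [FiniteDimensional ℂ (A x₀).ker] :
    ∃ (r : ℕ) (θ : X → (Fin r → ℂ) →L[ℂ] M) (ρ : M →L[ℂ] (Fin r → ℂ)) (R : X → N →L[ℂ] M),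
      ∀ᶠ x in 𝓝 x₀, ContinuousAt θ x ∧ ContinuousAt R x ∧ (∀ z, ρ (θ x z) = z) ∧
        (∀ n, A x (R x n) = n) ∧ (∀ z, A x (θ x z) = 0) ∧ ∀ m, R x (A x m) + θ x (ρ m) = m := by
  obtain ⟨p, hp⟩ := Submodule.ClosedComplemented.of_finiteDimensional (A x₀).ker
  let q : (A x₀).ker ≃L[ℂ] (Fin (Module.finrank ℂ (A x₀).ker) → ℂ) :=
    ContinuousLinearEquiv.ofFinrankEq (by simp)
  let ρ := (q : (A x₀).ker →L[ℂ] (Fin (Module.finrank ℂ (A x₀).ker) → ℂ)).comp p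
  -- Bordering `A x` by coordinates on the fixed space `ker (A x₀)` makes it invertible at `x₀`,
  -- hence nearby; the two columns of the inverse are `R` and `θ`.
  let Φ x := (A x).prod ρ
  have hΦ₀ : Function.Bijective (Φ x₀) := by
    constructor
    · rw [injective_iff_map_eq_zero]
      intro m hm
      have h1 : A x₀ m = 0 := congrArg Prod.fst hm
      have h2 : q (p m) = 0 := congrArg Prod.snd hm
      have h3 := hp ⟨m, h1⟩
      rw [q.map_eq_zero_iff] at h2
      rw [h2] at h3
      exact (congrArg Subtype.val h3).symm
    · rintro ⟨n, z⟩
      obtain ⟨m, rfl⟩ := hs n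
      refine ⟨m + (q.symm z - p m : (A x₀).ker), Prod.ext ?_ ?_⟩
      · have : A x₀ ((q.symm z - p m : (A x₀).ker) : M) = 0 := (q.symm z - p m).2
        change A x₀ (m + _) = A x₀ m
        rw [map_add, this, add_zero]
      · change q (p (m + _)) = z
        rw [map_add, hp]
        simp
  let Ψ : M ≃L[ℂ] N × (Fin (Module.finrank ℂ (A x₀).ker) → ℂ) :=
    ContinuousLinearEquiv.ofBijective (Φ x₀) (LinearMap.ker_eq_bot.2 hΦ₀.1)
      (LinearMap.range_eq_top.2 hΦ₀.2)
  have hΨ : (Ψ : M →L[ℂ] _) = Φ x₀ := by ext1 m; rfl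
  have hΦc : ∀ᶠ x in 𝓝 x₀, ContinuousAt Φ x := hA.mono fun x hx => by
    have : Continuous fun T : M →L[ℂ] N => T.prod ρ := by
      have h (T : M →L[ℂ] N) : T.prod ρ =
          (ContinuousLinearMap.inl ℂ N _).comp T + (ContinuousLinearMap.inr ℂ N _).comp ρ := by
        ext <;> simp
      simp_rw [h]
      fun_prop
    exact this.continuousAt.comp hx
  have hinv : ∀ᶠ x in 𝓝 x₀, Φ x ∈ Set.range
      ((↑) : (M ≃L[ℂ] N × (Fin (Module.finrank ℂ (A x₀).ker) → ℂ)) → M →L[ℂ] _) :=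
    hΦc.self_of_nhds.eventually (ContinuousLinearEquiv.isOpen.mem_nhds ⟨Ψ, hΨ⟩)
  refine ⟨_, fun x => (Φ x).inverse.comp (.inr ℂ _ _), ρ,
    fun x => (Φ x).inverse.comp (.inl ℂ _ _), ?_⟩
  filter_upwards [hinv, hΦc] with x ⟨e, he⟩ hx
  have hG : ContinuousAt (fun x => (Φ x).inverse) x := by
    have := (contDiffAt_map_inverse (n := 0) e).continuousAt
    rw [he] at this
    exact this.comp hx
  have h1 : ∀ y, Φ x ((Φ x).inverse y) = y := by
    intro y
    rw [← he, ContinuousLinearMap.inverse_equiv]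
    simp
  have h2 : ∀ m, (Φ x).inverse (Φ x m) = m := by
    intro y
    rw [← he, ContinuousLinearMap.inverse_equiv]
    simp
  refine ⟨hG.clm_comp continuousAt_const, hG.clm_comp continuousAt_const, fun z => ?_, fun n => ?_,
    fun z => ?_, fun m => ?_⟩
  · exact congrArg Prod.snd (h1 (0, z))
  · exact congrArg Prod.fst (h1 (n, 0))
  · exact congrArg Prod.fst (h1 (0, z))
  · change (Φ x).inverse (A x m, 0) + (Φ x).inverse (0, ρ m) = m
    rw [← map_add, Prod.mk_add_mk, add_zero, zero_add]
    exact h2 m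

/-! ### Continuity of sections of Hilbert bundles, and partitions of unity. -/

section Sections

variable {B : Type*} [TopologicalSpace B] {F : Type*} {E : B → Type*}

/-- In a trivialization the base coordinate of the map is `β`, so only the fibre coordinate carries
information. -/
theorem Bundle.Trivialization.continuousAt_mk_iff [TopologicalSpace F]
    [TopologicalSpace (TotalSpace F E)] (e : Trivialization F (π F E))
    {X : Type*} [TopologicalSpace X] {β : X → B} {f : ∀ x, E (β x)} {x₀ : X}
    (hβ : ContinuousAt β x₀) (h : β x₀ ∈ e.baseSet) :
    ContinuousAt (fun x => (⟨β x, f x⟩ : TotalSpace F E)) x₀ ↔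
      ContinuousAt (fun x => (e ⟨β x, f x⟩).2) x₀ := by
  have hev : ∀ᶠ x in 𝓝 x₀, β x ∈ e.baseSet := hβ.eventually (e.open_baseSet.mem_nhds h)
  rw [e.toOpenPartialHomeomorph.continuousAt_iff_continuousAt_comp_left
    (hev.mono fun x hx => e.mem_source.2 hx)]
  have : (e.toOpenPartialHomeomorph ∘ fun x => (⟨β x, f x⟩ : TotalSpace F E)) =ᶠ[𝓝 x₀]
      fun x => (β x, (e ⟨β x, f x⟩).2) :=
    hev.mono fun x hx => Prod.ext (e.coe_fst (e.mem_source.2 hx)) rfl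
  rw [continuousAt_congr this]
  exact ⟨fun h => h.snd, fun h => hβ.prodMk h⟩

variable [NormedAddCommGroup F] [InnerProductSpace ℂ F] [CompleteSpace F]
  [∀ b, NormedAddCommGroup (E b)] [∀ b, InnerProductSpace ℂ (E b)]
  [TopologicalSpace (TotalSpace F E)] [FiberBundle F E] [HilbertBundle F E]
  {X : Type*} [TopologicalSpace X] {β : X → B}

instance HilbertBundle.isLinear_trivializationAt (b : B) :
    (trivializationAt F E b).IsLinear ℂ :=
  HilbertBundle.trivialization_linear _

namespace HilbertBundle

/-- The transition functions need not be norm continuous, but a single fibrewise linear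
trivialization turns the operation into that of the model fibre. -/
theorem continuousAt_add {f g : ∀ x, E (β x)} {x₀ : X}
    (hf : ContinuousAt (fun x => (⟨β x, f x⟩ : TotalSpace F E)) x₀)
    (hg : ContinuousAt (fun x => (⟨β x, g x⟩ : TotalSpace F E)) x₀) :
    ContinuousAt (fun x => (⟨β x, f x + g x⟩ : TotalSpace F E)) x₀ := by
  have hβ : ContinuousAt β x₀ := (FiberBundle.continuous_proj F E).continuousAt.comp hf
  have hb := FiberBundle.mem_baseSet_trivializationAt' (F := F) (E := E) (β x₀)
  set e := trivializationAt F E (β x₀)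
  rw [e.continuousAt_mk_iff hβ hb] at hf hg ⊢
  refine (hf.add hg).congr ((hβ.eventually (e.open_baseSet.mem_nhds hb)).mono fun x hx => ?_)
  exact ((e.linear ℂ hx).map_add _ _).symm

theorem continuousAt_smul {c : X → ℂ} {f : ∀ x, E (β x)} {x₀ : X} (hc : ContinuousAt c x₀)
    (hf : ContinuousAt (fun x => (⟨β x, f x⟩ : TotalSpace F E)) x₀) :
    ContinuousAt (fun x => (⟨β x, c x • f x⟩ : TotalSpace F E)) x₀ := by
  have hβ : ContinuousAt β x₀ := (FiberBundle.continuous_proj F E).continuousAt.comp hf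
  have hb := FiberBundle.mem_baseSet_trivializationAt' (F := F) (E := E) (β x₀)
  set e := trivializationAt F E (β x₀)
  rw [e.continuousAt_mk_iff hβ hb] at hf ⊢
  refine (hc.smul hf).congr ((hβ.eventually (e.open_baseSet.mem_nhds hb)).mono fun x hx => ?_)
  exact ((e.linear ℂ hx).map_smul _ _).symm

theorem continuousAt_zero {x₀ : X} (hβ : ContinuousAt β x₀) :
    ContinuousAt (fun x => (⟨β x, 0⟩ : TotalSpace F E)) x₀ := by
  have hb := FiberBundle.mem_baseSet_trivializationAt' (F := F) (E := E) (β x₀)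
  set e := trivializationAt F E (β x₀)
  rw [e.continuousAt_mk_iff hβ hb]
  refine (continuousAt_const (y := (0 : F))).congr
    ((hβ.eventually (e.open_baseSet.mem_nhds hb)).mono fun x hx => ?_)
  exact ((e.linear ℂ hx).map_zero).symm

theorem continuousAt_sum {ι : Type*} (s : Finset ι) {f : ι → ∀ x, E (β x)} {x₀ : X}
    (hβ : ContinuousAt β x₀)
    (hf : ∀ i ∈ s, ContinuousAt (fun x => (⟨β x, f i x⟩ : TotalSpace F E)) x₀) :
    ContinuousAt (fun x => (⟨β x, ∑ i ∈ s, f i x⟩ : TotalSpace F E)) x₀ := by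
  classical
  induction s using Finset.induction_on with
  | empty => simpa using continuousAt_zero hβ
  | insert i s hi ih =>
    simp_rw [Finset.sum_insert hi]
    exact continuousAt_add (hf i (by simp)) (ih fun j hj => hf j (by simp [hj]))

/-- Cutting off a section that is continuous on a neighbourhood of the support of `χ`. -/
theorem continuous_cutoff {χ : B → ℂ} (hχ : Continuous χ) {W : Set B} (hW : tsupport χ ⊆ W)
    {f : ∀ b, E b} (hf : ∀ b ∈ W, ContinuousAt (fun b => (⟨b, f b⟩ : TotalSpace F E)) b) :
    Continuous fun b => (⟨b, χ b • f b⟩ : TotalSpace F E) := by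
  rw [continuous_iff_continuousAt]
  intro b
  by_cases hb : b ∈ tsupport χ
  · exact continuousAt_smul hχ.continuousAt (hf b (hW hb))
  · refine (continuousAt_zero (F := F) (E := E) (β := id) continuousAt_id).congr ?_
    filter_upwards [(isClosed_tsupport χ).isOpen_compl.mem_nhds hb] with x hx
    have : χ x = 0 := image_eq_zero_of_notMem_tsupport hx
    simp [this]

end HilbertBundle

end Sections

/-- A partition of unity on a compact Hausdorff space, subordinate to given neighbourhoods of its
points. -/
theorem exists_finite_partition {B : Type*} [TopologicalSpace B] [T2Space B] [CompactSpace B]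
    (W : B → Set B) (hW : ∀ b, W b ∈ 𝓝 b) :
    ∃ (t : Finset B) (χ : t → B → ℂ), (∀ i, Continuous (χ i)) ∧ (∀ i, tsupport (χ i) ⊆ W i) ∧
      ∀ b, ∑ i, χ i b = 1 := by
  obtain ⟨t, ht⟩ := isCompact_univ.elim_nhds_subcover (fun b => interior (W b))
    fun b _ => interior_mem_nhds.2 (hW b)
  obtain ⟨f, hf⟩ := PartitionOfUnity.exists_isSubordinate isClosed_univ
    (fun i : t => interior (W i)) (fun _ => isOpen_interior) fun b hb => by
      obtain ⟨i, hi, h⟩ := Set.mem_iUnion₂.1 (ht.2 hb)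
      exact Set.mem_iUnion.2 ⟨⟨i, hi⟩, h⟩
  refine ⟨t, fun i b => (f i b : ℂ), fun i => by fun_prop, fun i => ?_, fun b => ?_⟩
  · refine subset_trans (closure_mono fun b hb => ?_) ((hf i).trans interior_subset)
    simpa using hb
  · have := f.sum_eq_one (Set.mem_univ b)
    rw [finsum_eq_sum_of_fintype] at this
    dsimp only
    exact_mod_cast this

theorem Bundle.Trivialization.continuousAt_symm_mk {B F : Type*} {E : B → Type*}
    [TopologicalSpace B] [TopologicalSpace F] [TopologicalSpace (TotalSpace F E)]
    [∀ b, Zero (E b)]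
    (e : Trivialization F (π F E)) {X : Type*} [TopologicalSpace X] {β : X → B} {f : X → F} {x₀ : X}
    (hβ : ContinuousAt β x₀) (h : β x₀ ∈ e.baseSet) (hf : ContinuousAt f x₀) :
    ContinuousAt (fun x => (⟨β x, e.symm (β x) (f x)⟩ : TotalSpace F E)) x₀ := by
  rw [e.continuousAt_mk_iff hβ h]
  refine hf.congr ((hβ.eventually (e.open_baseSet.mem_nhds h)).mono fun x hx => ?_)
  dsimp only
  rw [e.apply_mk_symm hx]

/-! ### Finite rank bundles: inverting bundle maps, and gluing kernel bundles from frames. -/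

/-- A continuous fibrewise linear bijection of vector bundles of finite rank is an isomorphism. -/
noncomputable def CVectBundle.Iso.ofContinuous {B : Type*} [TopologicalSpace B]
    {V W : CVectBundle B} (f : ∀ b, V.E b ≃ₗ[ℂ] W.E b)
    (hf : Continuous fun p : V.Total => (⟨p.1, f p.1 p.2⟩ : W.Total)) : Iso V W where
  toEquiv := f
  continuous_toFun := hf
  continuous_invFun := by
    rw [continuous_iff_continuousAt]
    intro q₀
    have hb := FiberBundle.mem_baseSet_trivializationAt' (F := V.F) (E := V.E) q₀.1
    have hb' := FiberBundle.mem_baseSet_trivializationAt' (F := W.F) (E := W.E) q₀.1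
    set e := trivializationAt V.F V.E q₀.1
    set e' := trivializationAt W.F W.E q₀.1
    have := FiniteDimensional.complete ℂ V.F
    -- `C` is `f` in the trivializations, defined for every `b`; `c` records that it is invertible
    -- over the base sets.
    let C (b : B) : V.F →L[ℂ] W.F :=
      LinearMap.toContinuousLinearMap (e'.linearMapAt ℂ b ∘ₗ (f b).toLinearMap ∘ₗ e.symmₗ ℂ b)
    let c (b : B) (h : b ∈ e.baseSet) (h' : b ∈ e'.baseSet) : V.F ≃L[ℂ] W.F :=
      ((e.linearEquivAt ℂ b h).symm ≪≫ₗ f b ≪≫ₗ e'.linearEquivAt ℂ b h').toContinuousLinearEquiv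
    have hcC (b : B) (h : b ∈ e.baseSet) (h' : b ∈ e'.baseSet) : (c b h h' : V.F →L[ℂ] W.F) = C b := by
      ext v
      simp [C, c, h, h']
    have hC : ContinuousAt C q₀.1 := by
      -- The model fibre has finite dimension, so pointwise continuity is norm continuity, and
      -- inversion preserves it.
      rw [continuousAt_clm_apply]
      intro v
      have h1 : ContinuousAt (fun b => (⟨b, e.symm b v⟩ : V.Total)) q₀.1 :=
        e.continuousAt_symm_mk continuousAt_id hb continuousAt_const
      have h2 : ContinuousAt (fun b => (⟨b, f b (e.symm b v)⟩ : W.Total)) q₀.1 :=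
        hf.continuousAt.comp h1
      replace h2 := (e'.continuousAt_mk_iff (β := fun b => b) continuousAt_id hb').1 h2
      refine h2.congr ?_
      filter_upwards [e.open_baseSet.mem_nhds hb, e'.open_baseSet.mem_nhds hb'] with b h h'
      simp [C, h, h']
    have hCi : ContinuousAt (fun b => (C b).inverse) q₀.1 := by
      have := (contDiffAt_map_inverse (𝕜 := ℂ) (n := 0) (c q₀.1 hb hb')).continuousAt
      rw [hcC] at this
      exact this.comp hC
    have hproj : ContinuousAt (fun q : W.Total => q.1) q₀ := (continuous_proj W).continuousAt
    rw [e.continuousAt_mk_iff hproj hb]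
    have h3 : ContinuousAt (fun q : W.Total => (e' ⟨q.1, q.2⟩).2) q₀ :=
      (e'.continuousAt_mk_iff hproj hb').1 continuousAt_id
    have h4 : ContinuousAt (fun q : W.Total => (C q.1).inverse) q₀ := hCi.comp (x := q₀) hproj
    refine (h4.clm_apply h3).congr ?_
    filter_upwards [hproj.eventually (e.open_baseSet.mem_nhds hb),
      hproj.eventually (e'.open_baseSet.mem_nhds hb')] with q h h'
    rw [← hcC q.1 h h', ContinuousLinearMap.inverse_equiv]
    simp only [c, ContinuousLinearEquiv.coe_coe]
    rw [← ContinuousLinearEquiv.coe_toLinearEquiv, ContinuousLinearEquiv.toLinearEquiv_symm]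
    simp only [LinearEquiv.toLinearEquiv_toContinuousLinearEquiv]
    simp only [LinearEquiv.trans_symm, LinearEquiv.trans_apply, LinearEquiv.symm_symm,
      Trivialization.linearEquivAt_symm_apply, Trivialization.linearEquivAt_apply]
    rw [e'.symm_apply_apply_mk h']

section Kernel

variable {B : Type*} [TopologicalSpace B]
  {F : Type*} [NormedAddCommGroup F] [InnerProductSpace ℂ F]
  {F' : Type*} [NormedAddCommGroup F'] [InnerProductSpace ℂ F']
  {E : B → Type*} [∀ b, NormedAddCommGroup (E b)] [∀ b, InnerProductSpace ℂ (E b)]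
  [TopologicalSpace (TotalSpace F E)] [FiberBundle F E]
  {E' : B → Type*} [∀ b, NormedAddCommGroup (E' b)] [∀ b, InnerProductSpace ℂ (E' b)]
  [TopologicalSpace (TotalSpace F' E')] [FiberBundle F' E']

/-- A continuous frame `θ` of the kernels of a family `S` on a neighbourhood `W` of a point,
together with the coordinates `ρ` that it defines. -/
structure KernelFrame (F : Type*) [NormedAddCommGroup F] [InnerProductSpace ℂ F]
    [TopologicalSpace (TotalSpace F E)] [FiberBundle F E]
    {l : ℕ} (S : ∀ b, E b × (Fin l → ℂ) →ₗ[ℂ] E' b) (r : ℕ) where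
  W : Set B
  isOpen_W : IsOpen W
  θ : ∀ b, (Fin r → ℂ) →ₗ[ℂ] E b × (Fin l → ℂ)
  ρ : ∀ b, E b × (Fin l → ℂ) →ₗ[ℂ] (Fin r → ℂ)
  ρ_θ : ∀ b ∈ W, ∀ z, ρ b (θ b z) = z
  range_θ : ∀ b ∈ W, LinearMap.range (θ b) = LinearMap.ker (S b)
  continuousAt_θ : ∀ p : B × (Fin r → ℂ), p.1 ∈ W → ContinuousAt (fun p : B × (Fin r → ℂ) =>
    (((⟨p.1, (θ p.1 p.2).1⟩ : TotalSpace F E), (θ p.1 p.2).2) : TotalSpace F E × (Fin l → ℂ))) p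
  continuousAt_ρ : ∀ p : TotalSpace F E × (Fin l → ℂ), p.1.1 ∈ W →
    ContinuousAt (fun p : TotalSpace F E × (Fin l → ℂ) => ρ p.1.1 (p.1.2, p.2)) p

namespace KernelFrame

variable {l : ℕ} {S : ∀ b, E b × (Fin l → ℂ) →ₗ[ℂ] E' b} {r : ℕ}

theorem θ_ρ (K : KernelFrame F S r) {b : B} (hb : b ∈ K.W) {m : E b × (Fin l → ℂ)}
    (hm : S b m = 0) : K.θ b (K.ρ b m) = m := by
  obtain ⟨z, rfl⟩ : m ∈ LinearMap.range (K.θ b) := by rw [K.range_θ b hb]; exact hm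
  rw [K.ρ_θ b hb]

theorem S_θ (K : KernelFrame F S r) {b : B} (hb : b ∈ K.W) (z : Fin r → ℂ) :
    S b (K.θ b z) = 0 := by
  have : K.θ b z ∈ LinearMap.ker (S b) := by rw [← K.range_θ b hb]; exact ⟨z, rfl⟩
  exact this

/-- The kernel bundle glued from local frames. -/
noncomputable def core (K : B → KernelFrame F S r) (hK : ∀ b, b ∈ (K b).W) :
    VectorBundleCore ℂ B (Fin r → ℂ) B where
  baseSet i := (K i).W
  isOpen_baseSet i := (K i).isOpen_W
  indexAt b := b
  mem_baseSet_at := hK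
  coordChange i j b := LinearMap.toContinuousLinearMap ((K j).ρ b ∘ₗ (K i).θ b)
  coordChange_self i b hb v := (K i).ρ_θ b hb v
  continuousOn_coordChange i j := by
    rw [continuousOn_clm_apply]
    intro v b hb
    have h1 : ContinuousAt (fun b : B => (b, v)) b := by fun_prop
    have h2 := ((K i).continuousAt_θ (b, v) hb.1).comp (x := b) h1
    exact (((K j).continuousAt_ρ ⟨⟨b, ((K i).θ b v).1⟩, ((K i).θ b v).2⟩ hb.2).comp
      (x := b) h2).continuousWithinAt
  -- The middle factor `θ ∘ ρ` of the frame `j` is the identity on the kernel, where the frame `i`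
  -- takes its values.
  coordChange_comp i j k b hb v :=
    congrArg ((K k).ρ b) ((K j).θ_ρ hb.1.2 ((K i).S_θ hb.1.1 v))

/-- The kernels of a family that has local frames of constant rank form a vector bundle. -/
theorem exists_isKernelBundle (K : B → KernelFrame F S r) (hK : ∀ b, b ∈ (K b).W) :
    ∃ V : CVectBundle B, IsKernelBundle F S V := by
  let Z := core K hK
  -- The fibre over `b` holds coordinates in the frame attached to `b` itself; by `hloc`, the
  -- coordinates in any other frame represent the same kernel vector.
  let ι (b : B) : Z.Fiber b →ₗ[ℂ] E b × (Fin l → ℂ) := (K b).θ b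
  have hker (b : B) (v : Z.Fiber b) : S b (ι b v) = 0 := (K b).S_θ (hK b) v
  let tot (p : TotalSpace (Fin r → ℂ) Z.Fiber) : TotalSpace F E × (Fin l → ℂ) :=
    (⟨p.1, (ι p.1 p.2).1⟩, (ι p.1 p.2).2)
  have hinj (b : B) : Function.Injective (ι b) :=
    Function.LeftInverse.injective (g := (K b).ρ b) ((K b).ρ_θ b (hK b))
  have hloc (i : B) (p : TotalSpace (Fin r → ℂ) Z.Fiber) (hp : p.1 ∈ (K i).W) :
      (K i).θ p.1 (Z.localTriv i p).2 = ι p.1 p.2 := (K i).θ_ρ hp (hker _ _)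
  have hcont : Continuous tot := by
    rw [continuous_iff_continuousAt]
    intro p
    have h1 : ContinuousAt (fun q => Z.localTriv p.1 q) p :=
      (Z.localTriv p.1).continuousAt ((Z.localTriv p.1).mem_source.2 (hK p.1))
    refine (((K p.1).continuousAt_θ (Z.localTriv p.1 p) (hK p.1)).comp (x := p) h1).congr ?_
    filter_upwards [Z.continuous_proj.continuousAt.eventually
      ((K p.1).isOpen_W.mem_nhds (hK p.1))] with q hq
    have := hloc p.1 q hq
    simp only [Function.comp, tot]
    rw [← this]
    rfl
  refine ⟨{ F := Fin r → ℂ, E := Z.Fiber }, ι, hinj, fun b => (K b).range_θ b (hK b), ?_⟩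
  have hinjtot : Function.Injective tot := by
    rintro ⟨b, v⟩ ⟨b', v'⟩ h
    obtain rfl : b = b' := congrArg (fun x => x.1.1) h
    have h1 : (ι b v).1 = (ι b v').1 := by
      have := congrArg Prod.fst h
      simpa [tot] using this
    have h2 : (ι b v).2 = (ι b v').2 := (Prod.ext_iff.1 h).2
    rw [hinj b (Prod.ext h1 h2)]
  refine ⟨isInducing_iff_nhds.2 fun p => le_antisymm hcont.continuousAt.le_comap ?_, hinjtot⟩
  -- The coordinates `ρ` give a left inverse of `tot` over a neighbourhood of `p.1`, continuous at
  -- `tot p`; this forces the topology to be induced.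
  let g (y : TotalSpace F E × (Fin l → ℂ)) : TotalSpace (Fin r → ℂ) Z.Fiber :=
    (Z.localTriv p.1).toOpenPartialHomeomorph.symm (y.1.1, (K p.1).ρ y.1.1 (y.1.2, y.2))
  have hg : ContinuousAt g (tot p) := by
    have h1 : ContinuousAt (Z.localTriv p.1).toOpenPartialHomeomorph.symm
        (p.1, (K p.1).ρ p.1 ((ι p.1 p.2).1, (ι p.1 p.2).2)) :=
      (Z.localTriv p.1).toOpenPartialHomeomorph.continuousAt_symm
        ((Z.localTriv p.1).mem_target.2 (hK p.1))
    have h2 : ContinuousAt (fun y : TotalSpace F E × (Fin l → ℂ) => y.1.1) (tot p) :=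
      ((FiberBundle.continuous_proj F E).comp continuous_fst).continuousAt
    exact h1.comp (f := fun y : TotalSpace F E × (Fin l → ℂ) =>
      (y.1.1, (K p.1).ρ y.1.1 (y.1.2, y.2))) (h2.prodMk ((K p.1).continuousAt_ρ (tot p) (hK p.1)))
  have hgt (q : TotalSpace (Fin r → ℂ) Z.Fiber) (hq : q.1 ∈ (K p.1).W) : g (tot q) = q :=
    (Z.localTriv p.1).toOpenPartialHomeomorph.left_inv ((Z.localTriv p.1).mem_source.2 hq)
  have h3 : Filter.Tendsto (g ∘ tot) (Filter.comap tot (𝓝 (tot p))) (𝓝 p) := by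
    have := hg.tendsto
    rw [hgt p (hK p.1)] at this
    exact this.comp Filter.tendsto_comap
  refine Filter.tendsto_id'.1 (h3.congr' ?_)
  have h4 : ∀ᶠ y in 𝓝 (tot p), y.1.1 ∈ (K p.1).W :=
    ((FiberBundle.continuous_proj F E).comp continuous_fst).continuousAt.eventually
      ((K p.1).isOpen_W.mem_nhds (hK p.1))
  filter_upwards [Filter.tendsto_comap.eventually h4] with q hq
  exact hgt q hq

end KernelFrame

end Kernel

/-! ### Stabilized families in linear trivializations. -/

section LinearTrivialization

variable {B : Type*} [TopologicalSpace B]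
  {F : Type*} [NormedAddCommGroup F] [InnerProductSpace ℂ F]
  {E : B → Type*} [∀ b, NormedAddCommGroup (E b)] [∀ b, InnerProductSpace ℂ (E b)]
  [TopologicalSpace (TotalSpace F E)] [FiberBundle F E]
  (e : Trivialization F (π F E)) [e.IsLinear ℂ]
  {X : Type*} [TopologicalSpace X] {β : X → B} {x₀ : X}

theorem Bundle.Trivialization.continuousAt_mk_iff_continuousLinearMapAt {f : ∀ x, E (β x)}
    (hβ : ContinuousAt β x₀) (h : β x₀ ∈ e.baseSet) :
    ContinuousAt (fun x => (⟨β x, f x⟩ : TotalSpace F E)) x₀ ↔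
      ContinuousAt (fun x => e.continuousLinearMapAt ℂ (β x) (f x)) x₀ := by
  rw [e.continuousAt_mk_iff hβ h]
  refine continuousAt_congr ((hβ.eventually (e.open_baseSet.mem_nhds h)).mono fun x hx => ?_)
  exact (e.continuousLinearMapAt_apply_of_mem (R := ℂ) hx _).symm

theorem Bundle.Trivialization.continuousAt_symmL_mk {f : X → F}
    (hβ : ContinuousAt β x₀) (h : β x₀ ∈ e.baseSet) (hf : ContinuousAt f x₀) :
    ContinuousAt (fun x => (⟨β x, e.symmL ℂ (β x) (f x)⟩ : TotalSpace F E)) x₀ := by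
  rw [e.continuousAt_mk_iff_continuousLinearMapAt hβ h]
  refine hf.congr ((hβ.eventually (e.open_baseSet.mem_nhds h)).mono fun x hx => ?_)
  exact (e.continuousLinearMapAt_symmL hx _).symm

end LinearTrivialization

section Algebra

variable {B : Type*}
  {E : B → Type*} [∀ b, NormedAddCommGroup (E b)] [∀ b, InnerProductSpace ℂ (E b)]
  {E' : B → Type*} [∀ b, NormedAddCommGroup (E' b)] [∀ b, InnerProductSpace ℂ (E' b)]
  {T : ∀ b, E b →L[ℂ] E' b}

/-- In this form surjectivity visibly persists when sections are added or rescaled by nonzero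
numbers. -/
theorem stabilized_surjective_iff {l : ℕ} (w : Fin l → ∀ b, E' b) (b : B) :
    Function.Surjective (stabilized T w b) ↔
      (T b).range ⊔ Submodule.span ℂ (Set.range fun k => w k b) = ⊤ := by
  rw [← LinearMap.range_eq_top]
  suffices LinearMap.range (stabilized T w b) =
    (T b).range ⊔ Submodule.span ℂ (Set.range fun k => w k b) by rw [this]
  ext y
  simp only [LinearMap.mem_range, Submodule.mem_sup, Submodule.mem_span_range_iff_exists_fun,
    stabilized, LinearMap.coe_mk, AddHom.coe_mk]
  constructor
  · rintro ⟨p, rfl⟩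
    exact ⟨_, ⟨p.1, rfl⟩, _, ⟨p.2, rfl⟩, rfl⟩
  · rintro ⟨_, ⟨u, rfl⟩, _, ⟨z, rfl⟩, rfl⟩
    exact ⟨(u, z), rfl⟩

/-- An element `(u, 0)` of this kernel has `u ∈ ker (T b)`. Hence, for an algebraic projection `p`
onto `ker (T b)`, the map `(u, z) ↦ (p u, z)` is injective on it. -/
theorem finiteDimensional_ker_stabilized {l : ℕ} (w : Fin l → ∀ b, E' b) (b : B)
    (hT : (T b).IsFredholm) : FiniteDimensional ℂ (LinearMap.ker (stabilized T w b)) := by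
  have := hT.finite_ker
  obtain ⟨p, hp⟩ := (T b).ker.subtype.exists_leftInverse_of_injective (T b).ker.ker_subtype
  refine Module.Finite.of_injective
    ((p.prodMap LinearMap.id) ∘ₗ (LinearMap.ker (stabilized T w b)).subtype) ?_
  rw [injective_iff_map_eq_zero]
  rintro ⟨⟨u, z⟩, hm⟩ h
  obtain rfl : z = 0 := congrArg Prod.snd h
  have hu : p u = 0 := congrArg Prod.fst h
  have hTu : T b u = 0 := by simpa [stabilized] using hm
  have := LinearMap.congr_fun hp ⟨u, hTu⟩
  have hu0 : u = 0 := by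
    have h2 : (p u : E b) = u := congrArg Subtype.val this
    rw [← h2, hu]; rfl
  subst hu0
  rfl

end Algebra

section Stabilization

variable {B : Type*} [TopologicalSpace B]
  {F : Type*} [NormedAddCommGroup F] [InnerProductSpace ℂ F]
  {F' : Type*} [NormedAddCommGroup F'] [InnerProductSpace ℂ F']
  {E : B → Type*} [∀ b, NormedAddCommGroup (E b)] [∀ b, InnerProductSpace ℂ (E b)]
  [TopologicalSpace (TotalSpace F E)] [FiberBundle F E]
  {E' : B → Type*} [∀ b, NormedAddCommGroup (E' b)] [∀ b, InnerProductSpace ℂ (E' b)]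
  [TopologicalSpace (TotalSpace F' E')] [FiberBundle F' E']
  {T : ∀ b, E b →L[ℂ] E' b}

variable [CompleteSpace F] [CompleteSpace F']

/-- Near a point where the stabilized family is surjective, it stays surjective, its kernels have
a continuous frame, and continuous sections can be lifted. -/
theorem exists_kernelFrame (hT : IsFredholmFamily F F' T) {l : ℕ} {w : Fin l → ∀ b, E' b} {b₀ : B}
    (hw : ∀ᶠ b in 𝓝 b₀, ∀ k, ContinuousAt (fun b => (⟨b, w k b⟩ : TotalSpace F' E')) b)
    (hs : Function.Surjective (stabilized T w b₀)) :
    ∃ (r : ℕ) (K : KernelFrame F (stabilized T w) r), b₀ ∈ K.W ∧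
      (∀ b ∈ K.W, Function.Surjective (stabilized T w b)) ∧
      ∀ v : ∀ b, E' b, (∀ b ∈ K.W, ContinuousAt (fun b => (⟨b, v b⟩ : TotalSpace F' E')) b) →
        ∃ s : ∀ b, E b × (Fin l → ℂ), ∀ b ∈ K.W, stabilized T w b (s b) = v b ∧
          ContinuousAt (fun b => (⟨b, (s b).1⟩ : TotalSpace F E)) b ∧
          ContinuousAt (fun b => (s b).2) b := by
  obtain ⟨e, e', _, _, hb, hc⟩ := hT.normContinuous b₀
  set U := e.baseSet ∩ e'.baseSet
  have hU : IsOpen U := e.open_baseSet.inter e'.open_baseSet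
  -- The stabilized family in the trivializations; `σ` and `τ` pass between the model space and the
  -- fibre, and are mutually inverse over `U`.
  let A (b : B) : F × (Fin l → ℂ) →L[ℂ] F' :=
    ((e'.continuousLinearMapAt ℂ b).comp ((T b).comp (e.symmL ℂ b))).comp (.fst ℂ _ _) +
      ∑ k, ContinuousLinearMap.smulRight
        ((ContinuousLinearMap.proj k : (Fin l → ℂ) →L[ℂ] ℂ).comp (.snd ℂ F (Fin l → ℂ)))
        (e'.continuousLinearMapAt ℂ b (w k b))
  let σ (b : B) : F × (Fin l → ℂ) →L[ℂ] E b × (Fin l → ℂ) :=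
    (e.symmL ℂ b).prodMap (.id ℂ _)
  let τ (b : B) : E b × (Fin l → ℂ) →L[ℂ] F × (Fin l → ℂ) :=
    (e.continuousLinearMapAt ℂ b).prodMap (.id ℂ _)
  have hστ (b : B) (hb : b ∈ U) (m) : σ b (τ b m) = m :=
    Prod.ext (e.symmL_continuousLinearMapAt hb.1 _) rfl
  have hτσ (b : B) (hb : b ∈ U) (m) : τ b (σ b m) = m :=
    Prod.ext (e.continuousLinearMapAt_symmL hb.1 _) rfl
  have hAS (b : B) (m) :
      A b m = e'.continuousLinearMapAt ℂ b (stabilized T w b (σ b m)) := by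
    simp [A, σ, stabilized]
  have hinj' (b : B) (hb : b ∈ U) : Function.Injective (e'.continuousLinearMapAt ℂ b) :=
    Function.LeftInverse.injective (e'.symmL_continuousLinearMapAt hb.2)
  have hSA (b : B) (hb : b ∈ U) (m) :
      e'.continuousLinearMapAt ℂ b (stabilized T w b m) = A b (τ b m) := by
    rw [hAS, hστ b hb]
  have hAc : ∀ᶠ b in 𝓝 b₀, ContinuousAt A b := by
    filter_upwards [hU.mem_nhds hb, hw] with b hbU hwb
    refine ContinuousAt.add ?_ (tendsto_finsetSum _ fun k _ => ?_)
    · exact (hc.continuousAt (hU.mem_nhds hbU)).clm_comp continuousAt_const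
    -- A section contributes an operator of rank at most one, which depends norm continuously on the
    -- vector spanning its image.
    · have h1 := (e'.continuousAt_mk_iff_continuousLinearMapAt (β := fun b => b) continuousAt_id
        hbU.2).1 (hwb k)
      exact ((ContinuousLinearMap.smulRightL ℂ (F × (Fin l → ℂ)) F'
        ((ContinuousLinearMap.proj k : (Fin l → ℂ) →L[ℂ] ℂ).comp
          (.snd ℂ F (Fin l → ℂ)))).continuous.continuousAt).comp h1
  have hAs : Function.Surjective (A b₀) := by
    intro y
    obtain ⟨m, hm⟩ := hs (e'.symmL ℂ b₀ y)
    refine ⟨τ b₀ m, ?_⟩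
    rw [← hSA b₀ hb, hm, e'.continuousLinearMapAt_symmL hb.2]
  have hfin : FiniteDimensional ℂ (A b₀).ker := by
    have := finiteDimensional_ker_stabilized (T := T) w b₀ (hT.isFredholm b₀)
    have hmem (m : (A b₀).ker) : (σ b₀).toLinearMap m ∈ LinearMap.ker (stabilized T w b₀) := by
      refine LinearMap.mem_ker.2 (hinj' b₀ hb ?_)
      rw [map_zero]
      exact (hAS b₀ m).symm.trans m.2
    refine Module.Finite.of_injective ((σ b₀).toLinearMap.restrict (fun m hm => hmem ⟨m, hm⟩)) ?_
    intro m m' h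
    have := congrArg (fun x => τ b₀ x.1) h
    exact Subtype.ext ((hτσ b₀ hb m).symm.trans (this.trans (hτσ b₀ hb m')))
  obtain ⟨r, θ, ρ, R, hev⟩ := exists_local_splitting hAc hAs
  obtain ⟨W, hWs, hWo, hW⟩ := mem_nhds_iff.1 (Filter.inter_mem (hU.mem_nhds hb) hev)
  have hσc {X : Type _} [TopologicalSpace X] {β : X → B} {x : X} (hβ : ContinuousAt β x)
      (hx : β x ∈ W) {f : X → F × (Fin l → ℂ)} (hf : ContinuousAt f x) :
      ContinuousAt (fun x => (⟨β x, (σ (β x) (f x)).1⟩ : TotalSpace F E)) x :=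
    e.continuousAt_symmL_mk hβ (hWs hx).1.1 hf.fst
  have hθc (p : B × (Fin r → ℂ)) (hp : p.1 ∈ W) :
      ContinuousAt (fun p : B × (Fin r → ℂ) => θ p.1 p.2) p :=
    ((hWs hp).2.1.comp (x := p) continuousAt_fst).clm_apply continuousAt_snd
  refine ⟨r, ⟨W, hWo, fun b => (σ b).toLinearMap ∘ₗ (θ b).toLinearMap,
    fun b => ρ.toLinearMap ∘ₗ (τ b).toLinearMap, fun b hb z => ?_, fun b hb => ?_, fun p hp => ?_,
    fun p hp => ?_⟩, hW, fun b hb y => ?_, fun v hv => ?_⟩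
  · change ρ (τ b (σ b (θ b z))) = z
    rw [hτσ b (hWs hb).1, (hWs hb).2.2.2.1]
  · obtain ⟨hbU, -, -, h1, h2, h3, h4⟩ := hWs hb
    ext m
    constructor
    · rintro ⟨z, rfl⟩
      refine LinearMap.mem_ker.2 (hinj' b hbU ?_)
      rw [map_zero]
      exact (hAS b (θ b z)).symm.trans (h3 z)
    · intro hm
      refine ⟨ρ (τ b m), ?_⟩
      have h5 : A b (τ b m) = 0 := by rw [← hSA b hbU, LinearMap.mem_ker.1 hm, map_zero]
      have h6 := h4 (τ b m)
      rw [h5, map_zero, zero_add] at h6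
      change σ b (θ b (ρ (τ b m))) = m
      rw [h6, hστ b hbU]
  · exact (hσc continuousAt_fst hp (hθc p hp)).prodMk (hθc p hp).snd
  · have h1 : ContinuousAt (fun p : TotalSpace F E × (Fin l → ℂ) =>
        e.continuousLinearMapAt ℂ p.1.1 p.1.2) p :=
      (e.continuousAt_mk_iff_continuousLinearMapAt
        (((FiberBundle.continuous_proj F E).comp continuous_fst).continuousAt)
        (hWs hp).1.1).1 continuousAt_fst
    exact ρ.continuous.continuousAt.comp (h1.prodMk continuousAt_snd)
  · obtain ⟨hbU, -, -, h1, h2, h3, h4⟩ := hWs hb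
    refine ⟨σ b (R b (e'.continuousLinearMapAt ℂ b y)), hinj' b hbU ?_⟩
    rw [← hAS, h2]
  -- The lift is the right inverse `R` of `A`, carried back to the bundles.
  · refine ⟨fun b => σ b (R b (e'.continuousLinearMapAt ℂ b (v b))), fun b hb => ?_⟩
    obtain ⟨hbU, -, hR, h1, h2, h3, h4⟩ := hWs hb
    have hc : ContinuousAt (fun b => R b (e'.continuousLinearMapAt ℂ b (v b))) b :=
      hR.clm_apply ((e'.continuousAt_mk_iff_continuousLinearMapAt (β := fun b => b)
        continuousAt_id hbU.2).1 (hv b hb))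
    refine ⟨hinj' b hbU ?_, hσc continuousAt_id hb hc, hc.snd⟩
    rw [← hAS, h2]

end Stabilization

/-! ### Global stabilizations, kernel bundles and lifts. -/

section Global

variable {B : Type*} [TopologicalSpace B] [T2Space B] [CompactSpace B]
  {F : Type*} [NormedAddCommGroup F] [InnerProductSpace ℂ F] [CompleteSpace F]
  {F' : Type*} [NormedAddCommGroup F'] [InnerProductSpace ℂ F'] [CompleteSpace F']
  {E : B → Type*} [∀ b, NormedAddCommGroup (E b)] [∀ b, InnerProductSpace ℂ (E b)]
  [TopologicalSpace (TotalSpace F E)] [FiberBundle F E]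
  {E' : B → Type*} [∀ b, NormedAddCommGroup (E' b)] [∀ b, InnerProductSpace ℂ (E' b)]
  [TopologicalSpace (TotalSpace F' E')] [FiberBundle F' E']
  {T : ∀ b, E b →L[ℂ] E' b}

/-- A Fredholm family becomes surjective after adding finitely many continuous sections. -/
theorem exists_stabilized_surjective [HilbertBundle F' E'] (hT : IsFredholmFamily F F' T) :
    ∃ (l : ℕ) (w : Fin l → ∀ b, E' b),
      (∀ k, Continuous fun b => (⟨b, w k b⟩ : TotalSpace F' E')) ∧
      ∀ b, Function.Surjective (stabilized T w b) := by
  have hloc (b₀ : B) : ∃ (l : ℕ) (w : Fin l → ∀ b, E' b) (W : Set B), W ∈ 𝓝 b₀ ∧ ∀ b ∈ W,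
      (∀ k, ContinuousAt (fun b => (⟨b, w k b⟩ : TotalSpace F' E')) b) ∧
      Function.Surjective (stabilized T w b) := by
    set e' := trivializationAt F' E' b₀
    have hb' : b₀ ∈ e'.baseSet := FiberBundle.mem_baseSet_trivializationAt' b₀
    have : Module.Finite ℂ (E' b₀ ⧸ (T b₀).range) := (hT.isFredholm b₀).finite_coker
    obtain ⟨l, s, hs⟩ := Module.Finite.exists_fin (R := ℂ) (M := E' b₀ ⧸ (T b₀).range)
    choose y hy using fun k => Submodule.mkQ_surjective _ (s k)
    -- Representatives `y k` of generators of the cokernel at `b₀`, extended as constants in the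
    -- trivialization.
    let w (k : Fin l) (b : B) : E' b := e'.symmL ℂ b (e'.continuousLinearMapAt ℂ b₀ (y k))
    have hwy (k : Fin l) : w k b₀ = y k := e'.symmL_continuousLinearMapAt hb' _
    have hw (b : B) (hb : b ∈ e'.baseSet) (k : Fin l) :
        ContinuousAt (fun b => (⟨b, w k b⟩ : TotalSpace F' E')) b :=
      e'.continuousAt_symmL_mk continuousAt_id hb continuousAt_const
    have hsur : Function.Surjective (stabilized T w b₀) := by
      rw [stabilized_surjective_iff]
      simp_rw [hwy]
      rw [← Submodule.map_mkQ_eq_top, Submodule.map_span, ← Set.range_comp, ← hs]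
      congr 2
      ext1 k
      exact hy k
    have hev : ∀ᶠ b in 𝓝 b₀, b ∈ e'.baseSet := e'.open_baseSet.mem_nhds hb'
    obtain ⟨r, K, hK, hKs, -⟩ := exists_kernelFrame hT (hev.mono hw) hsur
    exact ⟨l, w, K.W ∩ e'.baseSet, Filter.inter_mem (K.isOpen_W.mem_nhds hK) hev,
      fun b hb => ⟨hw b hb.2, hKs b hb.1⟩⟩
  choose l w W hW hWs using hloc
  obtain ⟨t, χ, hχc, hχW, hχ⟩ := exists_finite_partition W hW
  let σ := Fintype.equivFin (Σ i : t, Fin (l i))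
  refine ⟨_, fun k b => χ (σ.symm k).1 b • w (σ.symm k).1 (σ.symm k).2 b, fun k => ?_, fun b => ?_⟩
  · exact HilbertBundle.continuous_cutoff (hχc _) (hχW _) fun b hb => (hWs _ b hb).1 _
  · obtain ⟨i, hi⟩ : ∃ i, χ i b ≠ 0 := by
      by_contra! h
      simpa [h] using hχ b
    have hb : b ∈ W i := hχW i (subset_tsupport _ hi)
    have h1 := (stabilized_surjective_iff _ _).1 (hWs i b hb).2
    -- Since `χ i b ≠ 0`, the cut-off sections with index `i` still span at `b` what the local ones
    -- span.
    rw [stabilized_surjective_iff, eq_top_iff, ← h1]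
    refine sup_le_sup_left (Submodule.span_le.2 ?_) _
    rintro _ ⟨k, rfl⟩
    have h2 : χ i b • w i k b ∈ Submodule.span ℂ (Set.range fun k =>
        χ (σ.symm k).1 b • w (σ.symm k).1 (σ.symm k).2 b) :=
      Submodule.subset_span ⟨σ ⟨i, k⟩,
        congrArg (fun p : Σ i : t, Fin (l i) => χ p.1 b • w p.1 p.2 b) (σ.symm_apply_apply ⟨i, k⟩)⟩
    simpa [smul_smul, inv_mul_cancel₀ hi] using Submodule.smul_mem _ (χ i b)⁻¹ h2

variable {l : ℕ} {w : Fin l → ∀ b, E' b}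

omit [T2Space B] [CompactSpace B] in
/-- The kernels of a surjective stabilization of a Fredholm family form a vector bundle. -/
theorem exists_isKernelBundle_stabilized [PreconnectedSpace B] (hT : IsFredholmFamily F F' T)
    (hw : ∀ k, Continuous fun b => (⟨b, w k b⟩ : TotalSpace F' E'))
    (hs : ∀ b, Function.Surjective (stabilized T w b)) :
    ∃ V : CVectBundle B, IsKernelBundle F (stabilized T w) V := by
  choose r K hK hKs hlift using fun b₀ => exists_kernelFrame hT (b₀ := b₀)
    (Filter.Eventually.of_forall fun b k => (hw k).continuousAt) (hs b₀)
  have hr (b₀ b : B) (hb : b ∈ (K b₀).W) :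
      Module.finrank ℂ (LinearMap.ker (stabilized T w b)) = r b₀ := by
    rw [← (K b₀).range_θ b hb, LinearMap.finrank_range_of_inj
      (Function.LeftInverse.injective ((K b₀).ρ_θ b hb)), Module.finrank_fin_fun]
  have hconst : IsLocallyConstant
      fun b => Module.finrank ℂ (LinearMap.ker (stabilized T w b)) := by
    rw [IsLocallyConstant.iff_eventually_eq]
    intro b₀
    filter_upwards [(K b₀).isOpen_W.mem_nhds (hK b₀)] with b hb
    rw [hr b₀ b hb, hr b₀ b₀ (hK b₀)]
  -- The rank is a parameter of the type `KernelFrame`, so frames of provably equal rank must be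
  -- transported to a common one before gluing.
  have hframe (r₀ : ℕ) (h : ∀ b, r b = r₀) (b : B) :
      ∃ K : KernelFrame F (stabilized T w) r₀, b ∈ K.W := by
    obtain rfl := h b
    exact ⟨K b, hK b⟩
  cases isEmpty_or_nonempty B with
  | inl h => exact KernelFrame.exists_isKernelBundle (r := 0) (h.elim ·) (h.elim ·)
  | inr h =>
    obtain ⟨b₀⟩ := h
    choose K' hK' using hframe (r b₀) fun b => by
      rw [← hr b b (hK b), ← hr b₀ b₀ (hK b₀)]
      exact hconst.apply_eq_of_preconnectedSpace b b₀
    exact KernelFrame.exists_isKernelBundle K' hK'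

/-- Continuous sections lift through a surjective stabilization of a Fredholm family. -/
theorem exists_continuous_lift [HilbertBundle F E] (hT : IsFredholmFamily F F' T)
    (hw : ∀ k, Continuous fun b => (⟨b, w k b⟩ : TotalSpace F' E'))
    (hs : ∀ b, Function.Surjective (stabilized T w b))
    {v : ∀ b, E' b} (hv : Continuous fun b => (⟨b, v b⟩ : TotalSpace F' E')) :
    ∃ s : ∀ b, E b × (Fin l → ℂ), (∀ b, stabilized T w b (s b) = v b) ∧
      (Continuous fun b => (⟨b, (s b).1⟩ : TotalSpace F E)) ∧ Continuous fun b => (s b).2 := by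
  choose r K hK hKs hlift using fun b₀ => exists_kernelFrame hT (b₀ := b₀)
    (Filter.Eventually.of_forall fun b k => (hw k).continuousAt) (hs b₀)
  choose s hsv using fun b₀ => hlift b₀ v fun b _ => hv.continuousAt
  obtain ⟨t, χ, hχc, hχW, hχ⟩ := exists_finite_partition (fun b => (K b).W)
    fun b => (K b).isOpen_W.mem_nhds (hK b)
  -- The lifts of a given section form an affine space, so averaging local lifts with weights of sum
  -- `1` gives a lift.
  refine ⟨fun b => ∑ i, χ i b • s i b, fun b => ?_, ?_, ?_⟩
  · rw [map_sum]
    have (i : t) : stabilized T w b (χ i b • s i b) = χ i b • v b := by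
      rw [map_smul]
      by_cases h : χ i b = 0
      · simp [h]
      · rw [(hsv i b (hχW i (subset_tsupport _ h))).1]
    simp_rw [this, ← Finset.sum_smul, hχ, one_smul]
  · rw [continuous_iff_continuousAt]
    intro b
    simp_rw [Prod.fst_sum, Prod.smul_fst]
    exact HilbertBundle.continuousAt_sum (β := fun b => b) _ continuousAt_id fun i _ =>
      (HilbertBundle.continuous_cutoff (hχc i) (hχW i) fun b hb => (hsv i b hb).2.1).continuousAt
  · simp_rw [Prod.snd_sum, Prod.smul_snd]
    refine continuous_finsetSum _ fun i _ => continuous_of_tsupport fun b hb => ?_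
    exact (hχc i).continuousAt.smul (hsv i b (hχW i (tsupport_smul_subset_left _ _ hb))).2.2

end Global

theorem exists_linearEquiv_of_range_eq {X Y M : Type*} [AddCommGroup X] [Module ℂ X]
    [AddCommGroup Y] [Module ℂ Y] [AddCommGroup M] [Module ℂ M] {g : X →ₗ[ℂ] M} {h : Y →ₗ[ℂ] M}
    (hg : Function.Injective g) (hh : Function.Injective h)
    (H : LinearMap.range g = LinearMap.range h) : ∃ f : X ≃ₗ[ℂ] Y, ∀ x, h (f x) = g x := by
  refine ⟨(LinearEquiv.ofInjective g hg) ≪≫ₗ (LinearEquiv.ofEq _ _ H) ≪≫ₗ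
    (LinearEquiv.ofInjective h hh).symm, fun x => ?_⟩
  change ((LinearEquiv.ofInjective h hh) ((LinearEquiv.ofInjective h hh).symm _) : M) = g x
  rw [LinearEquiv.apply_symm_apply]
  rfl

/-! ### Independence of the index class from the stabilization. -/

section IndexClass

variable {B : Type*} [TopologicalSpace B]
  {F : Type*} [NormedAddCommGroup F] [InnerProductSpace ℂ F]
  {F' : Type*} [NormedAddCommGroup F'] [InnerProductSpace ℂ F']
  {E : B → Type*} [∀ b, NormedAddCommGroup (E b)] [∀ b, InnerProductSpace ℂ (E b)]
  [TopologicalSpace (TotalSpace F E)] [FiberBundle F E]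
  {E' : B → Type*} [∀ b, NormedAddCommGroup (E' b)] [∀ b, InnerProductSpace ℂ (E' b)]
  [TopologicalSpace (TotalSpace F' E')] [FiberBundle F' E']
  {T : ∀ b, E b →L[ℂ] E' b}

omit [NormedAddCommGroup F] [InnerProductSpace ℂ F] [FiberBundle F E] in
/-- A vector bundle that maps continuously and bijectively onto the kernels of a family is
isomorphic to the kernel bundle. -/
theorem IsKernelBundle.ofBundle_eq {l : ℕ} {S : ∀ b, E b × (Fin l → ℂ) →ₗ[ℂ] E' b}
    {V W : CVectBundle B} (hV : IsKernelBundle F S V) (g : ∀ b, W.E b →ₗ[ℂ] E b × (Fin l → ℂ))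
    (hg : ∀ b, Function.Injective (g b))
    (hr : ∀ b, LinearMap.range (g b) = LinearMap.ker (S b))
    (hc₁ : Continuous fun p : W.Total => (⟨p.1, (g p.1 p.2).1⟩ : TotalSpace F E))
    (hc₂ : Continuous fun p : W.Total => (g p.1 p.2).2) :
    KZero.ofBundle W = KZero.ofBundle V := by
  obtain ⟨ι, hι, hιr, hemb⟩ := hV
  choose f hf using fun b =>
    exists_linearEquiv_of_range_eq (hg b) (hι b) ((hr b).trans (hιr b).symm)
  suffices h : Continuous fun p : W.Total => (⟨p.1, f p.1 p.2⟩ : V.Total) by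
    have : VectClass.mk W = VectClass.mk V := Quotient.sound ⟨CVectBundle.Iso.ofContinuous f h⟩
    rw [KZero.ofBundle, KZero.ofBundle, this]
  -- The kernel bundle carries the induced topology, so `f` is continuous once `ι ∘ f = g` is.
  rw [hemb.isInducing.continuous_iff]
  refine (hc₁.prodMk hc₂).congr fun p => ?_
  simp [hf]

variable [T2Space B] [CompactSpace B] [CompleteSpace F] [CompleteSpace F']

/-- Adding further sections to a surjective stabilization adds a trivial bundle to the kernel
bundle. -/
theorem ofBundle_kernel_enlarge [HilbertBundle F E] (hT : IsFredholmFamily F F' T)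
    {l l' m : ℕ} (σ : Fin l ⊕ Fin l' ≃ Fin m) {w : Fin l → ∀ b, E' b} {v : Fin m → ∀ b, E' b}
    (hvw : ∀ k, v (σ (.inl k)) = w k)
    (hv : ∀ k, Continuous fun b => (⟨b, v k b⟩ : TotalSpace F' E'))
    (hs : ∀ b, Function.Surjective (stabilized T w b)) {V V' : CVectBundle B}
    (hV : IsKernelBundle F (stabilized T w) V) (hV' : IsKernelBundle F (stabilized T v) V') :
    KZero.ofBundle V + KZero.ofBundle (CVectBundle.trivial B (Fin l' → ℂ)) =
      KZero.ofBundle V' := by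
  have hw (k) : Continuous fun b => (⟨b, w k b⟩ : TotalSpace F' E') := by
    rw [← hvw]
    exact hv _
  -- `s j` lifts the additional section `v (σ (.inr j))` through the smaller stabilization.
  choose s hsv hs₁ hs₂ using fun j => exists_continuous_lift hT hw hs (hv (σ (.inr j)))
  obtain ⟨ι, hι, hιr, hemb⟩ := hV
  -- `N` only reindexes the coordinates along `σ`.
  let N (b : B) : (E b × (Fin l → ℂ)) × (Fin l' → ℂ) →ₗ[ℂ] E b × (Fin m → ℂ) :=
    { toFun p := (p.1.1, fun k => Sum.elim p.1.2 p.2 (σ.symm k))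
      map_add' p q := by
        refine Prod.ext rfl (funext fun k => ?_)
        rcases h : σ.symm k with i | i <;> simp [h]
      map_smul' c p := by
        refine Prod.ext rfl (funext fun k => ?_)
        rcases h : σ.symm k with i | i <;> simp [h] }
  have hNinl (b : B) (p) (k : Fin l) : (N b p).2 (σ (.inl k)) = p.1.2 k := by simp [N]
  have hNinr (b : B) (p) (k : Fin l') : (N b p).2 (σ (.inr k)) = p.2 k := by simp [N]
  have hN (b : B) (p) : stabilized T v b (N b p) =
      stabilized T w b p.1 + ∑ j, p.2 j • v (σ (.inr j)) b := by
    change T b p.1.1 + ∑ k, (N b p).2 k • v k b = T b p.1.1 + ∑ k, p.1.2 k • w k b + _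
    rw [← σ.sum_comp, Fintype.sum_sum_type, add_assoc]
    simp_rw [hNinl, hNinr, hvw]
  have hNinj (b : B) : Function.Injective (N b) := by
    intro p q h
    refine Prod.ext (Prod.ext (congrArg (·.1) h :) (funext fun k => ?_)) (funext fun k => ?_)
    · rw [← hNinl, h, hNinl]
    · rw [← hNinr, h, hNinr]
  have hNsurj (b : B) : Function.Surjective (N b) := by
    intro y
    refine ⟨((y.1, fun k => y.2 (σ (.inl k))), fun k => y.2 (σ (.inr k))),
      Prod.ext rfl (funext fun k => ?_)⟩
    obtain ⟨k | k, rfl⟩ := σ.surjective k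
    · rw [hNinl]
    · rw [hNinr]
  let D (b : B) : (Fin l' → ℂ) →ₗ[ℂ] E b × (Fin l → ℂ) :=
    Fintype.linearCombination ℂ fun j => s j b
  have hD (b : B) (z) : stabilized T w b (D b z) = ∑ j, z j • v (σ (.inr j)) b := by
    simp [D, Fintype.linearCombination_apply, hsv]
  -- Up to `N`, this is `(x, z) ↦ (ι x - ∑ j, z j • s j, z)`: subtracting the lifts cancels the
  -- contribution of the additional sections.
  let g (b : B) : V.E b × (Fin l' → ℂ) →ₗ[ℂ] E b × (Fin m → ℂ) :=
    N b ∘ₗ ((ι b ∘ₗ .fst ℂ _ _ - D b ∘ₗ .snd ℂ _ _).prod (.snd ℂ _ _))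
  have hgN (b : B) (p) : g b p = N b (ι b p.1 - D b p.2, p.2) := rfl
  have hg₁ (b : B) (x : V.E b) (z : Fin l' → ℂ) :
      (g b (x, z)).1 = (ι b x).1 + ∑ j, (-z j) • (s j b).1 := by
    rw [hgN]
    simp [N, D, Fintype.linearCombination_apply, sub_eq_add_neg, Prod.fst_sum]
  have hg₂ (b : B) (x : V.E b) (z : Fin l' → ℂ) (k : Fin l) :
      (g b (x, z)).2 (σ (.inl k)) = (ι b x).2 k - ∑ j, z j * (s j b).2 k := by
    rw [hgN, hNinl]
    simp [D, Fintype.linearCombination_apply, Prod.snd_sum]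
  have hz : Continuous fun p : (V.sum (CVectBundle.trivial B (Fin l' → ℂ))).Total =>
      (show Fin l' → ℂ from p.2.2) :=
    (Bundle.Trivial.homeomorphProd B (Fin l' → ℂ)).continuous.snd.comp
      (CVectBundle.continuous_sum_snd V (CVectBundle.trivial B (Fin l' → ℂ)))
  have hιc := hemb.continuous.comp (CVectBundle.continuous_sum_fst V
    (CVectBundle.trivial B (Fin l' → ℂ)))
  have hproj := CVectBundle.continuous_proj (V.sum (CVectBundle.trivial B (Fin l' → ℂ)))
  refine Eq.trans ?_ (hV'.ofBundle_eq (W := V.sum (CVectBundle.trivial B (Fin l' → ℂ))) g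
    (fun b => ?_) (fun b => ?_) ?_ ?_)
  · rw [KZero.ofBundle, KZero.ofBundle, KZero.ofBundle, VectClass.mk_sum, map_add]
  · change Function.Injective (fun p : V.E b × (Fin l' → ℂ) => g b p)
    rintro ⟨x, z⟩ ⟨x', z'⟩ h
    have h1 := hNinj b h
    obtain rfl : z = z' := congrArg Prod.snd h1
    have h2 : ι b x - D b z = ι b x' - D b z := congrArg Prod.fst h1
    rw [hι b (sub_left_injective h2)]
  · change LinearMap.range (g b) = _
    ext y
    rw [LinearMap.mem_ker]
    constructor
    · rintro ⟨p, rfl⟩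
      have : stabilized T w b (ι b p.1) = 0 := by
        rw [← LinearMap.mem_ker, ← hιr]
        exact ⟨_, rfl⟩
      rw [hgN, hN, map_sub, this, hD]
      simp
    · intro hy
      obtain ⟨⟨q, z⟩, rfl⟩ := hNsurj b y
      rw [hN] at hy
      have : q + D b z ∈ LinearMap.range (ι b) := by
        rw [hιr, LinearMap.mem_ker, map_add, hD]
        exact hy
      obtain ⟨x, hx⟩ := this
      refine ⟨(x, z), ?_⟩
      rw [hgN, hx, add_sub_cancel_right]
  · have hsum : Continuous fun p : (V.sum (CVectBundle.trivial B (Fin l' → ℂ))).Total =>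
        (⟨p.1, (ι p.1 p.2.1).1 + ∑ j, (-(show Fin l' → ℂ from p.2.2) j) • (s j p.1).1⟩ :
          TotalSpace F E) := by
      rw [continuous_iff_continuousAt]
      intro p
      refine HilbertBundle.continuousAt_add hιc.fst.continuousAt
        (HilbertBundle.continuousAt_sum _ hproj.continuousAt fun j _ =>
          HilbertBundle.continuousAt_smul ?_ ?_)
      · exact ((continuous_apply j).comp hz).neg.continuousAt
      · exact ((hs₁ j).comp hproj).continuousAt
    exact hsum.congr fun p => congrArg (TotalSpace.mk p.1) (hg₁ p.1 p.2.1 p.2.2).symm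
  · refine continuous_pi fun k => ?_
    obtain ⟨k | k, rfl⟩ := σ.surjective k
    · have hsum : Continuous fun p : (V.sum (CVectBundle.trivial B (Fin l' → ℂ))).Total =>
          (ι p.1 p.2.1).2 k - ∑ j, (show Fin l' → ℂ from p.2.2) j * (s j p.1).2 k :=
        ((continuous_apply k).comp hιc.snd).sub (continuous_finsetSum _ fun j _ =>
          ((continuous_apply j).comp hz).mul ((continuous_apply k).comp ((hs₂ j).comp hproj)))
      exact hsum.congr fun p => (hg₂ p.1 p.2.1 p.2.2 k).symm
    · refine ((continuous_apply k).comp hz).congr fun p => ?_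
      exact (hNinr p.1 (ι p.1 p.2.1 - D p.1 p.2.2, p.2.2) k).symm

/-- With `U` the kernel bundle for `w` and `w'` together, `[V] + [ℂ^l'] = [U] = [V'] + [ℂ^l]`. -/
theorem IsIndexClass.eq [HilbertBundle F E] [PreconnectedSpace B] (hT : IsFredholmFamily F F' T)
    {x y : KZero B} (hx : IsIndexClass F F' T x) (hy : IsIndexClass F F' T y) : x = y := by
  obtain ⟨l, w, V, hw, hws, hV, rfl⟩ := hx
  obtain ⟨l', w', V', hw', hws', hV', rfl⟩ := hy
  let σ : Fin l ⊕ Fin l' ≃ Fin (l + l') := finSumFinEquiv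
  let v (k : Fin (l + l')) : ∀ b, E' b := Sum.elim w w' (σ.symm k)
  have hvl (k) : v (σ (.inl k)) = w k := by simp [v]
  have hvr (k) : v (σ (.inr k)) = w' k := by simp [v]
  have hv (k) : Continuous fun b => (⟨b, v k b⟩ : TotalSpace F' E') := by
    obtain ⟨k | k, rfl⟩ := σ.surjective k
    · rw [hvl]; exact hw k
    · rw [hvr]; exact hw' k
  have hvs (b : B) : Function.Surjective (stabilized T v b) := by
    have h := (stabilized_surjective_iff _ _).1 (hws b)
    rw [stabilized_surjective_iff, eq_top_iff, ← h]
    refine sup_le_sup_left (Submodule.span_mono ?_) _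
    rintro _ ⟨k, rfl⟩
    exact ⟨σ (.inl k), by simp only [hvl]⟩
  obtain ⟨U, hU⟩ := exists_isKernelBundle_stabilized hT hv hvs
  have h₁ := ofBundle_kernel_enlarge hT σ hvl hv hws hV hU
  -- The summands are swapped so that `w'` plays the role of the original sections.
  have h₂ := ofBundle_kernel_enlarge hT ((Equiv.sumComm _ _).trans σ) hvr hv hws' hV' hU
  rw [sub_eq_sub_iff_add_eq_add, h₁, h₂]

theorem existsUnique_isIndexClass [HilbertBundle F E] [HilbertBundle F' E'] [PreconnectedSpace B]
    (hT : IsFredholmFamily F F' T) : ∃! x : KZero B, IsIndexClass F F' T x := by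
  obtain ⟨l, w, hw, hs⟩ := exists_stabilized_surjective hT
  obtain ⟨V, hV⟩ := exists_isKernelBundle_stabilized hT hw hs
  exact ⟨_, ⟨l, w, V, hw, hs, hV, rfl⟩, fun y hy => hy.eq hT ⟨l, w, V, hw, hs, hV, rfl⟩⟩

theorem IsIndexClass.indexBundle_eq [HilbertBundle F E] [PreconnectedSpace B]
    (hT : IsFredholmFamily F F' T) {x : KZero B} (hx : IsIndexClass F F' T x) :
    indexBundle F F' T = x := by
  have h : ∃ x, IsIndexClass F F' T x := ⟨x, hx⟩
  rw [indexBundle, dif_pos h]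
  exact h.choose_spec.eq hT hx

end IndexClass

/-! ### The five lemma for the stabilized families, and the conclusion. -/

section Comparison

variable {B : Type*}
  {E₁ : B → Type*} [∀ b, NormedAddCommGroup (E₁ b)] [∀ b, InnerProductSpace ℂ (E₁ b)]
  {E₁' : B → Type*} [∀ b, NormedAddCommGroup (E₁' b)] [∀ b, InnerProductSpace ℂ (E₁' b)]
  {E₂ : B → Type*} [∀ b, NormedAddCommGroup (E₂ b)] [∀ b, InnerProductSpace ℂ (E₂ b)]
  {E₂' : B → Type*} [∀ b, NormedAddCommGroup (E₂' b)] [∀ b, InnerProductSpace ℂ (E₂' b)]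
  {P : ∀ b, E₁ b →L[ℂ] E₁' b} {Q : ∀ b, E₂ b →L[ℂ] E₂' b}
  {φ : ∀ b, E₁ b →L[ℂ] E₂ b} {ψ : ∀ b, E₁' b →L[ℂ] E₂' b}
  (hcomm : ∀ b, (ψ b).comp (P b) = (Q b).comp (φ b)) {l : ℕ} (w : Fin l → ∀ b, E₁' b) (b : B)

include hcomm

theorem stabilized_map (m : E₁ b × (Fin l → ℂ)) :
    stabilized Q (fun k b => ψ b (w k b)) b (φ b m.1, m.2) = ψ b (stabilized P w b m) := by
  have := congrArg (fun T => T m.1) (hcomm b)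
  simp only [ContinuousLinearMap.comp_apply] at this
  simp [stabilized, this]

/-- Modulo the range of `Q b`, every `y` is `ψ b` of a value of the stabilized `P`; the error `Q b
u` is removed by changing the first component. -/
theorem stabilized_map_surjective
    (hη : Function.Surjective (inducedCoker (P b) (Q b) (φ b) (ψ b) (hcomm b)))
    (hs : Function.Surjective (stabilized P w b)) :
    Function.Surjective (stabilized Q (fun k b => ψ b (w k b)) b) := by
  intro y
  obtain ⟨x, hx⟩ := hη (Submodule.Quotient.mk y)
  obtain ⟨x, rfl⟩ := Submodule.Quotient.mk_surjective _ x
  obtain ⟨m, rfl⟩ := hs x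
  have h : ψ b (stabilized P w b m) - y ∈ (Q b).range := (Submodule.Quotient.eq _).1 hx
  obtain ⟨u, hu⟩ := h
  refine ⟨(φ b m.1, m.2) - (u, 0), ?_⟩
  rw [map_sub, stabilized_map hcomm]
  have : stabilized Q (fun k b => ψ b (w k b)) b (u, 0) = Q b u := by simp [stabilized]
  rw [this]
  change _ - Q b u = y
  rw [show Q b u = _ from hu, sub_sub_cancel]

/-- If `z = 0`, then `(u, z)` lies in the kernel exactly when `u ∈ Ker P`, where `φ` is injective by
hypothesis. -/
theorem stabilized_map_ker_injective
    (hμ : Function.Injective (inducedKer (P b) (Q b) (φ b) (ψ b) (hcomm b)))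
    {m : E₁ b × (Fin l → ℂ)} (hm : stabilized P w b m = 0) (h₁ : φ b m.1 = 0) (h₂ : m.2 = 0) :
    m = 0 := by
  obtain ⟨u, z⟩ := m
  obtain rfl : z = 0 := h₂
  have hu : P b u = 0 := by simpa [stabilized] using hm
  have := @hμ ⟨u, hu⟩ 0 (Subtype.ext (by simpa [inducedKer] using h₁))
  exact Prod.ext (congrArg Subtype.val this) rfl

/-- For `(v, z)` in the kernel, `ψ (∑ z k • w k) = -Q v` vanishes in `Coker Q`, so injectivity of
`η` gives `∑ z k • w k = P u`. Then `v + φ u ∈ Ker Q` equals `φ u'` with `u' ∈ Ker P`, and `u' - u`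
is the preimage. -/
theorem stabilized_map_ker_surjective
    (hμ : Function.Surjective (inducedKer (P b) (Q b) (φ b) (ψ b) (hcomm b)))
    (hη : Function.Injective (inducedCoker (P b) (Q b) (φ b) (ψ b) (hcomm b)))
    {m : E₂ b × (Fin l → ℂ)} (hm : stabilized Q (fun k b => ψ b (w k b)) b m = 0) :
    ∃ u, stabilized P w b (u, m.2) = 0 ∧ φ b u = m.1 := by
  obtain ⟨v, z⟩ := m
  have hm' : Q b v + ψ b (∑ k, z k • w k b) = 0 := by simpa [stabilized] using hm
  have h1 : (Submodule.Quotient.mk (∑ k, z k • w k b) : E₁' b ⧸ (P b).range) = 0 := by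
    refine hη ?_
    rw [map_zero]
    refine (Submodule.Quotient.mk_eq_zero _).2 ⟨-v, ?_⟩
    change Q b (-v) = ψ b _
    rw [map_neg, neg_eq_iff_add_eq_zero, hm']
  obtain ⟨u, hu⟩ := (Submodule.Quotient.mk_eq_zero _).1 h1
  replace hu : P b u = ∑ k, z k • w k b := hu
  have hQ : Q b (φ b u) = ψ b (P b u) := (congrArg (fun T => T u) (hcomm b)).symm
  have h2 : Q b (v + φ b u) = 0 := by rw [map_add, hQ, hu, hm']
  obtain ⟨⟨u', hu'⟩, h3⟩ := hμ ⟨v + φ b u, h2⟩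
  replace h3 : φ b u' = v + φ b u := congrArg Subtype.val h3
  replace hu' : P b u' = 0 := hu'
  refine ⟨u' - u, ?_, ?_⟩
  · simp [stabilized, hu, hu']
  · rw [map_sub, h3, add_sub_cancel_right]

end Comparison

theorem lemma1p3
    -- a connected closed manifold
    {n : ℕ} {B : Type*} [TopologicalSpace B] [T2Space B] [CompactSpace B] [ConnectedSpace B]
    [ChartedSpace (EuclideanSpace ℝ (Fin n)) B] [IsManifold (𝓡 n) ∞ B]
    -- four Hilbert bundles, with model fibres `F₁, F₁', F₂, F₂'`
    {F₁ : Type*} [NormedAddCommGroup F₁] [InnerProductSpace ℂ F₁] [CompleteSpace F₁]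
    {H₁ : B → Type*} [∀ b, NormedAddCommGroup (H₁ b)] [∀ b, InnerProductSpace ℂ (H₁ b)]
    [TopologicalSpace (TotalSpace F₁ H₁)] [FiberBundle F₁ H₁] [HilbertBundle F₁ H₁]
    {F₁' : Type*} [NormedAddCommGroup F₁'] [InnerProductSpace ℂ F₁'] [CompleteSpace F₁']
    {H₁' : B → Type*} [∀ b, NormedAddCommGroup (H₁' b)] [∀ b, InnerProductSpace ℂ (H₁' b)]
    [TopologicalSpace (TotalSpace F₁' H₁')] [FiberBundle F₁' H₁'] [HilbertBundle F₁' H₁']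
    {F₂ : Type*} [NormedAddCommGroup F₂] [InnerProductSpace ℂ F₂] [CompleteSpace F₂]
    {H₂ : B → Type*} [∀ b, NormedAddCommGroup (H₂ b)] [∀ b, InnerProductSpace ℂ (H₂ b)]
    [TopologicalSpace (TotalSpace F₂ H₂)] [FiberBundle F₂ H₂] [HilbertBundle F₂ H₂]
    {F₂' : Type*} [NormedAddCommGroup F₂'] [InnerProductSpace ℂ F₂'] [CompleteSpace F₂']
    {H₂' : B → Type*} [∀ b, NormedAddCommGroup (H₂' b)] [∀ b, InnerProductSpace ℂ (H₂' b)]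
    [TopologicalSpace (TotalSpace F₂' H₂')] [FiberBundle F₂' H₂'] [HilbertBundle F₂' H₂']
    -- two continuous families of Fredholm operators
    (P : ∀ b, H₁ b →L[ℂ] H₁' b) (hP : IsFredholmFamily F₁ F₁' P)
    (Q : ∀ b, H₂ b →L[ℂ] H₂' b) (hQ : IsFredholmFamily F₂ F₂' Q)
    -- continuous families of bounded operators that intertwine them
    (φ : ∀ b, H₁ b →L[ℂ] H₂ b) (hφ : IsContinuousBundleMap F₁ F₂ φ)
    (ψ : ∀ b, H₁' b →L[ℂ] H₂' b) (hψ : IsContinuousBundleMap F₁' F₂' ψ)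
    (hcomm : ∀ b, (ψ b).comp (P b) = (Q b).comp (φ b))
    -- the induced maps on kernels and on cokernels are isomorphisms
    (hμ : ∀ b, Function.Bijective (inducedKer (P b) (Q b) (φ b) (ψ b) (hcomm b)))
    (hη : ∀ b, Function.Bijective (inducedCoker (P b) (Q b) (φ b) (ψ b) (hcomm b))) :
    -- the index bundles are well defined and coincide
    (∃! x : KZero B, IsIndexClass F₁ F₁' P x) ∧ (∃! x : KZero B, IsIndexClass F₂ F₂' Q x) ∧
      indexBundle F₁ F₁' P = indexBundle F₂ F₂' Q := by
  refine ⟨existsUnique_isIndexClass hP, existsUnique_isIndexClass hQ, ?_⟩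
  obtain ⟨l, w, hw, hs⟩ := exists_stabilized_surjective hP
  obtain ⟨V, hV⟩ := exists_isKernelBundle_stabilized hP hw hs
  have hw' (k) : Continuous fun b => (⟨b, ψ b (w k b)⟩ : TotalSpace F₂' H₂') := hψ.comp (hw k)
  have hs' (b) := stabilized_map_surjective hcomm w b (hη b).2 (hs b)
  obtain ⟨V', hV'⟩ := exists_isKernelBundle_stabilized hQ hw' hs'
  have h₁ : IsIndexClass F₁ F₁' P _ := ⟨l, w, V, hw, hs, hV, rfl⟩
  have h₂ : IsIndexClass F₂ F₂' Q _ := ⟨l, _, V', hw', hs', hV', rfl⟩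
  rw [h₁.indexBundle_eq hP, h₂.indexBundle_eq hQ]
  -- Both stabilizations use the same `l`, so only the kernel bundles remain to be compared.
  congr 1
  obtain ⟨ι, hι, hιr, hemb⟩ := hV
  have hker (b) (x) : stabilized P w b (ι b x) = 0 := by
    rw [← LinearMap.mem_ker, ← hιr]
    exact ⟨x, rfl⟩
  -- `φ ⊕ id` carries the kernel bundle of the stabilized `P` onto that of the stabilized `Q`.
  refine hV'.ofBundle_eq (fun b => ((φ b).toLinearMap.prodMap .id) ∘ₗ ι b) (fun b => ?_)
    (fun b => ?_) (hφ.comp hemb.continuous.fst) hemb.continuous.snd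
  · rw [injective_iff_map_eq_zero]
    intro x hx
    refine (map_eq_zero_iff _ (hι b)).1 ?_
    exact stabilized_map_ker_injective hcomm w b (hμ b).1 (hker b x) (congrArg Prod.fst hx)
      (congrArg Prod.snd hx)
  · ext m
    rw [LinearMap.mem_ker]
    constructor
    · rintro ⟨x, rfl⟩
      refine (stabilized_map hcomm w b (ι b x)).trans ?_
      rw [hker, map_zero]
    · intro hm
      obtain ⟨u, hu, hum⟩ := stabilized_map_ker_surjective hcomm w b (hμ b).2 (hη b).1 hm
      obtain ⟨x, hx⟩ : (u, m.2) ∈ LinearMap.range (ι b) := by rw [hιr]; exact hu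
      refine ⟨x, ?_⟩
      rw [LinearMap.comp_apply, hx]
      exact Prod.ext hum rfl
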